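/- **Theorem 1 (High-probability reward error bound).** There is an absolute constant $C>0$ such that the following holds. *Setting.* Let $\mathsf S$ be a measurable space, $\mathsf A$ a finite set, $P(ds'\mid s,a)$ a Markov kernel from $\mathsf S\times\mathsf A$ to $\mathsf S$, $\gamma\in(0,1)$, $\lambda>0$. A policy is a Markov kernel $\pi(a\mid s)$ from $\mathsf S$ to $\mathsf A$. Let $\pi^\star$ be the expert policy, let $d$ be an invariant probability measure of the state kernel $\sum_a\pi^\star(a\mid s)P(ds'\mid s,a)$, and put $\rho^\star(ds,a)=d(ds)\,\pi^\star(a\mid s)$. Let $\mathrm P$ be the kernel of the state-action chain: from $(s,a)$ draw $s'\sim P(\cdot\mid s,a)$, then $a'\sim\pi^\star(\cdot\mid s')$. Assume that for some integer $\tau_{\rm mix}\ge 1$, for all $n\ge0$ and all $(s,a)$, $$\sup_B\big|\mathrm P^n((s,a),B)-\rho^\star(B)\big|\le (1/4)^{\lfloor n/\tau_{\rm mix}\rfloor}.$$ Let $\mathcal F$ be a class of policies with $\pi(a\mid s)\ge\alpha>0$ for all $\pi\in\mathcal F$ and all $(s,a)$, such that for some $D\ge1$, $\Lambda>0$ and all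 $\varepsilon\in(0,\Lambda]$ the covering numbers in the supremum norm over $\mathsf S\times\mathsf A$ satisfy $\log\mathcal N(\varepsilon,\mathcal F,\|\cdot\|_\infty)\le D\log(\Lambda/\varepsilon)$. Let $\mathcal R$ be a penalty on policies with $\mathcal R\ge0$ on $\mathcal F$. Let $N\ge 2\tau_{\rm mix}$ and $\alpha\,\tau_{\rm mix}\le\Lambda N$, and let $(S_1,A_1),\dots,(S_N,A_N)$ be a Markov chain with kernel $\mathrm P$ and arbitrary initial law. Let $$\widehat\pi\in\arg\min_{\pi\in\mathcal F}\Big\{\frac1N\sum_{t=1}^N-\log\pi(A_t\mid S_t)+\mathcal R(\pi)\Big\},\qquad \Delta(\mathcal F)=\inf_{\pi\in\mathcal F}\Big\{\mathbb E_{S\sim d}\,\mathrm{KL}\big(\pi^\star(\cdot\mid S)\mid\pi(\cdot\mid S)\big)+\mathcal R(\pi)\Big\}.$$ Let $\rho$ be a weighting measure (for instance a probability measure) on $\mathsf S\times\mathsf A$ with measurable density $w=d\rho/d\rho^\star$ such that $w_{\min}=\inf_{s,a}w(s,a)>0$ and $w_{\max}=\sup_{s,a}w(s,a)<\infty$, and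 put $\kappa=w_{\max}/w_{\min}$. For a policy $\pi$ let $f_\pi$ be a minimizer over $f\in L_2(d)$ of $$\int\Big(\lambda\log\pi(a\mid s)+f(s)-\gamma\int f(s')\,P(ds'\mid s,a)\Big)^2\rho(ds,da),$$ and let $R_\pi(s,a)=\lambda\log\pi(a\mid s)+f_\pi(s)-\gamma\int f_\pi(s')\,P(ds'\mid s,a)$ be the least-squares reward. Write $R^\star_{LS}=R_{\pi^\star}$ and $\widehat R=R_{\widehat\pi}$. *Claim.* For every $\delta\in(0,1)$, with $$M=\Big(D\log\frac{\Lambda N}{\alpha\,\tau_{\rm mix}}+\log\frac2\delta\Big)\Big(\log\frac1\alpha+2\Big),$$ with probability at least $1-\delta$ both $$\mathbb E_{S\sim d}\,\mathrm{KL}\big(\pi^\star(\cdot\mid S)\mid\widehat\pi(\cdot\mid S)\big)-\Delta(\mathcal F)\le C\Big(\frac{M\tau_{\rm mix}}N+\sqrt{\frac{\Delta(\mathcal F)\,M\tau_{\rm mix}}N}\Big)$$ and $$\|\widehat R-R^\star_{LS}\|_{L_2(\rho^\star)}^2\le C\,\lambda^2\kappa\Big(\log\frac1\alpha+2\Big)\Big(\Delta(\mathcal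 F)+\frac{M\tau_{\rm mix}}N\Big).$$ -/

import Mathlib

open MeasureTheory ProbabilityTheory
open scoped ENNReal NNReal

noncomputable section

/-- A stationary Markov policy: a Markov kernel from states to actions. -/
structure Policy (S A : Type*) [MeasurableSpace S] [MeasurableSpace A] where
  /-- the kernel `s ↦ π(· | s)` -/
  kernel : Kernel S A
  isMarkov : IsMarkovKernel kernel

namespace Policy

variable {S A : Type*} [MeasurableSpace S] [MeasurableSpace A]

instance (π : Policy S A) : IsMarkovKernel π.kernel := π.isMarkov

/-- The probability `π(a | s)`. -/
def prob (π : Policy S A) (s : S) (a : A) : ℝ := (π.kernel s).real {a}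

/-- The policy as a real function of the pair `(s, a)`, in the space of functions on
`S × A` with the (extended) supremum distance. -/
def toUniformFun (π : Policy S A) : UniformFun (S × A) ℝ :=
  UniformFun.ofFun (fun x : S × A => π.prob x.1 x.2)

/-- Every policy of the class gives each action, in each state, probability at least `α`. -/
def HasUniformFloor (F : Set (Policy S A)) (α : ℝ) : Prop :=
  ∀ π ∈ F, ∀ s a, α ≤ π.prob s a

/-- `log N(ε, F, ‖·‖_∞) ≤ D log (Λ / ε)` for all `ε ∈ (0, Λ]`, where `N` is the minimal number
of sup-norm balls of radius `ε` (with arbitrary centres) needed to cover `F`. The left-hand side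
is `⊤` if there is no finite cover. -/
def HasLogCovering (F : Set (Policy S A)) (D Λ : ℝ) : Prop :=
  ∀ ε : ℝ≥0, 0 < ε → (ε : ℝ) ≤ Λ →
    ENNReal.log ((Metric.externalCoveringNumber ε (toUniformFun '' F) : ℕ∞) : ℝ≥0∞)
      ≤ ((D * Real.log (Λ / ε) : ℝ) : EReal)

end Policy

section MDP

variable {S A : Type*} [MeasurableSpace S] [MeasurableSpace A]

/-- The state kernel `P_π(ds' | s) = ∑ a, π(a | s) P(ds' | s, a)`. -/
def stateKernel (P : Kernel (S × A) S) (π : Policy S A) : Kernel S S :=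
  P ∘ₖ (Kernel.id ×ₖ π.kernel)

/-- The kernel of the state-action chain: from `(s, a)`, draw `s' ∼ P(· | s, a)` and then
`a' ∼ π(· | s')`. -/
def jointKernel (P : Kernel (S × A) S) (π : Policy S A) : Kernel (S × A) (S × A) :=
  (Kernel.id ×ₖ π.kernel) ∘ₖ P

/-- The state-action law `d(ds) π(a | s)`. -/
def stateActionLaw (d : Measure S) (π : Policy S A) : Measure (S × A) :=
  d ⊗ₘ π.kernel

end MDP

/-- Uniform geometric ergodicity with mixing time `τ`: the total variation distance
`sup_B |K^n(x, B) - ρ(B)|` is at most `(1/4)^⌊n / τ⌋` for all `n` and `x`. -/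
def UniformlyGeomErgodic {X : Type*} [MeasurableSpace X] (K : Kernel X X) (ρ : Measure X)
    (τ : ℕ) : Prop :=
  1 ≤ τ ∧ ∀ (n : ℕ) (x : X) (B : Set X), MeasurableSet B →
    |((K ^ n) x).real B - ρ.real B| ≤ (1 / 4 : ℝ) ^ (n / τ)

/-- `Z 0, …, Z (N - 1)` is a time-homogeneous Markov chain with transition kernel `K` (and
arbitrary initial law): the joint law of `(Z 0, …, Z (t + 1))` is that of `(Z 0, …, Z t)` followed
by one step of `K` from the last coordinate. -/
structure IsMarkovChain {Ω X : Type*} [MeasurableSpace Ω] [MeasurableSpace X] (μ : Measure Ω)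
    (K : Kernel X X) (N : ℕ) (Z : ℕ → Ω → X) : Prop where
  measurable : ∀ t < N, Measurable (Z t)
  step : ∀ t, t + 1 < N →
    μ.map (fun ω => ((fun i : Fin (t + 1) => Z i ω), Z (t + 1) ω)) =
      (μ.map (fun ω => (fun i : Fin (t + 1) => Z i ω))) ⊗ₘ
        (K.comap (fun z : Fin (t + 1) → X => z (Fin.last t)) (measurable_pi_apply _))

section Estimation

variable {S A : Type*} [MeasurableSpace S] [MeasurableSpace A]

/-- The empirical negative log-likelihood `(1/N) ∑_t -log π(A_t | S_t)`. -/
def empiricalLoss (N : ℕ) (z : ℕ → S × A) (π : Policy S A) : ℝ :=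
  (1 / (N : ℝ)) * ∑ t ∈ Finset.range N, -Real.log (π.prob (z t).1 (z t).2)

/-- `πhat` minimizes the penalized empirical negative log-likelihood over the class `F`. -/
def IsPenalizedMLE (F : Set (Policy S A)) (pen : Policy S A → ℝ) (N : ℕ) (z : ℕ → S × A)
    (πhat : Policy S A) : Prop :=
  πhat ∈ F ∧ ∀ π ∈ F, empiricalLoss N z πhat + pen πhat ≤ empiricalLoss N z π + pen π

/-- The expected Kullback-Leibler divergence `E_{s ∼ d} KL(πstar(· | s) | π(· | s))`. -/
def expKL (d : Measure S) (πstar π : Policy S A) : ℝ :=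
  (∫⁻ s, InformationTheory.klDiv (πstar.kernel s) (π.kernel s) ∂d).toReal

/-- The penalized approximation error `Δ(F)`. -/
def approxError (d : Measure S) (πstar : Policy S A) (F : Set (Policy S A))
    (pen : Policy S A → ℝ) : ℝ :=
  ⨅ π : F, (expKL d πstar π + pen π)

/-- `M = (D log (Λ N / (α τ)) + log (2 / δ)) (log (1 / α) + 2)`. -/
def complexityM (D Λ : ℝ) (N : ℕ) (α : ℝ) (τ : ℕ) (δ : ℝ) : ℝ :=
  (D * Real.log (Λ * N / (α * τ)) + Real.log (2 / δ)) * (Real.log (1 / α) + 2)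

end Estimation

section Reward

variable {S A : Type*} [MeasurableSpace S] [MeasurableSpace A]

/-- The scaled log-policy `r_a(s) = lam * log π(a | s)`. -/
def logPolicy (lam : ℝ) (π : Policy S A) (x : S × A) : ℝ :=
  lam * Real.log (π.prob x.1 x.2)

/-- `(B_a f)(s) = f(s) - γ ∫ f(s') P(ds' | s, a)`. -/
def bellmanOp (P : Kernel (S × A) S) (γ : ℝ) (f : S → ℝ) (x : S × A) : ℝ :=
  f x.1 - γ * ∫ s', f s' ∂(P x)

/-- The shaped reward `R_f(s, a) = r_a(s) + (B_a f)(s)` attached to a policy and a potential. -/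
def shapedReward (P : Kernel (S × A) S) (γ lam : ℝ) (π : Policy S A) (f : S → ℝ)
    (x : S × A) : ℝ :=
  logPolicy lam π x + bellmanOp P γ f x

/-- The least-squares objective `J(f) = ∫ R_f² dρ`. -/
def lsObjective (P : Kernel (S × A) S) (γ lam : ℝ) (ρ : Measure (S × A)) (π : Policy S A)
    (f : S → ℝ) : ℝ≥0∞ :=
  ∫⁻ x, ENNReal.ofReal (shapedReward P γ lam π f x ^ 2) ∂ρ

/-- `f` is a least-squares potential of the policy `π`: it minimizes the objective over
`L²(d)`. -/
def IsLSPotential (P : Kernel (S × A) S) (γ lam : ℝ) (d : Measure S) (ρ : Measure (S × A))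
    (π : Policy S A) (f : S → ℝ) : Prop :=
  MemLp f 2 d ∧ ∀ g : S → ℝ, MemLp g 2 d →
    lsObjective P γ lam ρ π f ≤ lsObjective P γ lam ρ π g

end Reward

end

/-! Put `K(π) = expKL d πstar π`, `L = log (1/α)` and `e = M τ / N`. The argument compares the
empirical and mean log-likelihood ratios of the estimator and a fixed near-minimizer `π₀` of the
penalized risk. Two facts produce the fast rate.

The first is a Bernstein bound for the chain that needs no reversibility. After `3 τ` steps the
kernel is within `1/64` of its invariant law in total variation, uniformly in the starting point.
Along that skeleton the backward recursion for the moment generating function is controlled through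
its mean, its `L²` deviation from the mean and its sup deviation, all at once (`kernelMGF_bounds`).
The bound is uniform in the starting point, so the initial law is irrelevant. Jensen's inequality
over the interleaved skeletons recovers the whole sum (`IsMarkovChain.lintegral_exp_sum_le`), and
Chernoff's method gives `IsMarkovChain.measure_sum_ge_le`.

The second is that the variance is controlled by the risk: the elementary inequality
`sq_le_mul_exp_neg_add_sub_one` bounds the second moment of a log-ratio against the expert by `2 (L
+ 2) K(π)`. Only the competitor `π` needs the floor `α`; the expert may give some actions
probability zero. The deviation in `measure_logRatio_deviation_le` is thus `θ (K(π) + K(π₀))` plus a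
multiple of `τ (L + 2) x / (N θ)`, with `θ` free.

A union bound over a net of radius `α τ / N`, together with the minimizing property of the
estimator, yields an inequality in which `K` of the estimator appears on both sides. Choosing `θ` of
order `√(e / (Δ + e))` and solving keeps the coefficient of `Δ` equal to one
(`sub_le_of_quadratic_oracle`).

For the rewards, the least-squares residual is orthogonal in `L²(ρ)` to the range of the Bellman
operator, so by Pythagoras it depends on the log-policy without expansion. Passing between `ρ` and
the state-action law costs `κ`, and the second-moment bound turns the log-policy error into `K`. -/

/-! ### Integrals under measures close in total variation -/

section TotalVariation

variable {X : Type*} [MeasurableSpace X]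

theorem Measurable.integrable_of_abs_le {μ : Measure X} [IsFiniteMeasure μ] {φ : X → ℝ}
    (hφ : Measurable φ) {c : ℝ} (hc : ∀ x, |φ x| ≤ c) : Integrable φ μ :=
  Integrable.of_bound hφ.aestronglyMeasurable c (Filter.Eventually.of_forall hc)

/-- The difference of two probability measures at total variation distance at most `η` is given by
a density of `L¹` norm at most `2 η`, dominated by a density of their sum. -/
theorem exists_density_sub (p q : Measure X) [IsProbabilityMeasure p] [IsProbabilityMeasure q]
    {η : ℝ} (h : ∀ B, MeasurableSet B → |p.real B - q.real B| ≤ η) :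
    ∃ (ν : Measure X) (k l : X → ℝ), Integrable k ν ∧ Integrable l ν ∧
      (∀ x, |k x| ≤ l x) ∧ ∫ x, |k x| ∂ν ≤ 2 * η ∧
      (∀ φ : X → ℝ, Measurable φ → ∀ c, (∀ x, |φ x| ≤ c) →
        ∫ x, φ x ∂p - ∫ x, φ x ∂q = ∫ x, φ x * k x ∂ν ∧
        ∫ x, φ x ∂p + ∫ x, φ x ∂q = ∫ x, φ x * l x ∂ν) := by
  set ν := p + q with hν
  have hp : p ≪ ν := Measure.AbsolutelyContinuous.rfl.add_right q
  have hq : q ≪ ν := by rw [hν, add_comm]; exact Measure.AbsolutelyContinuous.rfl.add_right p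
  set u : X → ℝ := fun x => (p.rnDeriv ν x).toReal
  set v : X → ℝ := fun x => (q.rnDeriv ν x).toReal
  have hu : Integrable u ν := Measure.integrable_toReal_rnDeriv
  have hv : Integrable v ν := Measure.integrable_toReal_rnDeriv
  have hum : Measurable u := (Measure.measurable_rnDeriv p ν).ennreal_toReal
  have hvm : Measurable v := (Measure.measurable_rnDeriv q ν).ennreal_toReal
  have hu0 : ∀ x, 0 ≤ u x := fun x => ENNReal.toReal_nonneg
  have hv0 : ∀ x, 0 ≤ v x := fun x => ENNReal.toReal_nonneg
  have key : ∀ φ : X → ℝ, Measurable φ → ∀ c, (∀ x, |φ x| ≤ c) →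
        ∫ x, φ x ∂p - ∫ x, φ x ∂q = ∫ x, φ x * (u x - v x) ∂ν ∧
        ∫ x, φ x ∂p + ∫ x, φ x ∂q = ∫ x, φ x * (u x + v x) ∂ν := by
    intro φ hφ c hc
    have h1 : ∫ x, φ x * u x ∂ν = ∫ x, φ x ∂p := by
      rw [← integral_rnDeriv_smul hp]
      simp only [smul_eq_mul, mul_comm, u]
    have h2 : ∫ x, φ x * v x ∂ν = ∫ x, φ x ∂q := by
      rw [← integral_rnDeriv_smul hq]
      simp only [smul_eq_mul, mul_comm, v]
    have i1 : Integrable (fun x => φ x * u x) ν :=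
      hu.bdd_mul hφ.aestronglyMeasurable (Filter.Eventually.of_forall hc)
    have i2 : Integrable (fun x => φ x * v x) ν :=
      hv.bdd_mul hφ.aestronglyMeasurable (Filter.Eventually.of_forall hc)
    rw [← h1, ← h2, ← integral_sub i1 i2, ← integral_add i1 i2]
    simp only [mul_sub, mul_add, and_self]
  refine ⟨ν, fun x => u x - v x, fun x => u x + v x, hu.sub hv, hu.add hv, ?_, ?_, key⟩
  · intro x
    rw [abs_le]
    constructor <;> linarith [hu0 x, hv0 x]
  -- `E` is the Hahn set of `p - q`; testing against the sign `φ` turns the `L¹` norm into a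
  -- difference of integrals, and `E` and its complement each contribute at most `η`.
  · set E : Set X := {x | v x ≤ u x}
    have hE : MeasurableSet E := measurableSet_le hvm hum
    set φ : X → ℝ := fun x => E.indicator (fun _ => (1 : ℝ)) x - Eᶜ.indicator (fun _ => (1 : ℝ)) x
    have hφ : Measurable φ :=
      (measurable_const.indicator hE).sub (measurable_const.indicator hE.compl)
    have hφ1 : ∀ x, |φ x| ≤ 1 := by
      intro x
      by_cases hx : x ∈ E <;> simp [φ, hx]
    have h3 : ∀ x, |u x - v x| = φ x * (u x - v x) := by
      intro x
      by_cases hx : x ∈ E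
      · have : v x ≤ u x := hx
        simp [φ, hx, abs_of_nonneg (sub_nonneg.2 this)]
      · have : u x ≤ v x := (not_le.1 hx).le
        simp [φ, hx, abs_of_nonpos (sub_nonpos.2 this)]
    have h4 : ∀ r : Measure X, IsProbabilityMeasure r → ∫ x, φ x ∂r = r.real E - r.real Eᶜ := by
      intro r hr
      rw [integral_sub, integral_indicator_const _ hE, integral_indicator_const _ hE.compl]
      · simp
      · exact (integrable_const _).indicator hE
      · exact (integrable_const _).indicator hE.compl
    simp_rw [h3]
    rw [← (key φ hφ 1 hφ1).1, h4 p inferInstance, h4 q inferInstance]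
    have := abs_le.1 (h E hE)
    have := abs_le.1 (h Eᶜ hE.compl)
    linarith

theorem abs_integral_sub_integral_le (p q : Measure X) [IsProbabilityMeasure p]
    [IsProbabilityMeasure q] {η : ℝ} (h : ∀ B, MeasurableSet B → |p.real B - q.real B| ≤ η)
    {φ : X → ℝ} (hφ : Measurable φ) {c : ℝ} (hc0 : 0 ≤ c) (hc : ∀ x, |φ x| ≤ c) :
    |∫ x, φ x ∂p - ∫ x, φ x ∂q| ≤ 2 * η * c := by
  obtain ⟨ν, k, l, hk, hl, hkl, hη, key⟩ := exists_density_sub p q h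
  rw [(key φ hφ c hc).1]
  calc |∫ x, φ x * k x ∂ν| ≤ ∫ x, |φ x * k x| ∂ν := abs_integral_le_integral_abs
    _ ≤ ∫ x, c * |k x| ∂ν := by
        apply integral_mono
        · exact (hk.bdd_mul hφ.aestronglyMeasurable (Filter.Eventually.of_forall hc)).abs
        · exact hk.abs.const_mul c
        · intro x
          simp only [abs_mul]
          exact mul_le_mul_of_nonneg_right (hc x) (abs_nonneg _)
    _ = c * ∫ x, |k x| ∂ν := integral_const_mul _ _
    _ ≤ 2 * η * c := by nlinarith

/-- Cauchy-Schwarz for the weight `|k|`: one factor is its mass, at most `2 η`, and the other is a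
second moment, where `|k| ≤ l`. This makes total variation closeness a contraction in `L²`, where
the sup-norm bound would lose the variance. -/
theorem sq_integral_sub_integral_le (p q : Measure X) [IsProbabilityMeasure p]
    [IsProbabilityMeasure q] {η : ℝ} (h : ∀ B, MeasurableSet B → |p.real B - q.real B| ≤ η)
    {φ : X → ℝ} (hφ : Measurable φ) {c : ℝ} (hc : ∀ x, |φ x| ≤ c) :
    (∫ x, φ x ∂p - ∫ x, φ x ∂q) ^ 2 ≤ 2 * η * (∫ x, φ x ^ 2 ∂p + ∫ x, φ x ^ 2 ∂q) := by
  obtain ⟨ν, k, l, hk, hl, hkl, hη, key⟩ := exists_density_sub p q h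
  have hc2 : ∀ x, |φ x ^ 2| ≤ c ^ 2 := fun x => by
    rw [abs_pow]; exact pow_le_pow_left₀ (abs_nonneg _) (hc x) 2
  rw [(key φ hφ c hc).1, (key (fun x => φ x ^ 2) (hφ.pow_const 2) (c ^ 2) hc2).2]
  set I := ∫ x, φ x * k x ∂ν
  set W := ∫ x, φ x ^ 2 * l x ∂ν
  set m := ∫ x, |k x| ∂ν
  have hW : Integrable (fun x => φ x ^ 2 * l x) ν :=
    hl.bdd_mul (hφ.pow_const 2).aestronglyMeasurable (Filter.Eventually.of_forall hc2)
  have hI : Integrable (fun x => φ x * k x) ν :=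
    hk.bdd_mul hφ.aestronglyMeasurable (Filter.Eventually.of_forall hc)
  have hW0 : 0 ≤ W := integral_nonneg fun x =>
    mul_nonneg (sq_nonneg _) ((abs_nonneg _).trans (hkl x))
  -- Cauchy-Schwarz through the discriminant of this nonnegative quadratic in `t`.
  have quad : ∀ t : ℝ, 0 ≤ W - 2 * t * I + t ^ 2 * m := by
    intro t
    have : W - 2 * t * I + t ^ 2 * m
        = ∫ x, (φ x ^ 2 * l x - 2 * t * (φ x * k x) + t ^ 2 * |k x|) ∂ν := by
      have i1 : Integrable (fun x => 2 * t * (φ x * k x)) ν := hI.const_mul _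
      have i2 : Integrable (fun x => φ x ^ 2 * l x - 2 * t * (φ x * k x)) ν := hW.sub i1
      rw [integral_add i2 (hk.abs.const_mul _), integral_sub hW i1, integral_const_mul,
        integral_const_mul]
    rw [this]
    apply integral_nonneg
    intro x
    have h1 := mul_le_mul_of_nonneg_left (hkl x) (sq_nonneg (φ x))
    have h2 : 2 * t * (φ x * k x) ≤ (φ x ^ 2 + t ^ 2) * |k x| := by
      rcases le_total 0 (k x) with hx | hx
      · rw [abs_of_nonneg hx]; nlinarith [mul_nonneg (sq_nonneg (φ x - t)) hx]
      · rw [abs_of_nonpos hx]; nlinarith [mul_nonneg (sq_nonneg (φ x + t)) (neg_nonneg.2 hx)]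
    show 0 ≤ φ x ^ 2 * l x - 2 * t * (φ x * k x) + t ^ 2 * |k x|
    nlinarith
  have hm : I ^ 2 ≤ m * W := by
    have := discrim_le_zero (a := m) (b := -2 * I) (c := W) (fun t => by nlinarith [quad t])
    unfold discrim at this
    nlinarith
  exact hm.trans (mul_le_mul_of_nonneg_right hη hW0)

end TotalVariation

/-! ### Exponential moments along a rapidly mixing kernel -/

section MomentGeneratingFunction

variable {X : Type*} [MeasurableSpace X]

/-- `kernelMGF Q f n x` is the expectation of `f (Y 1) ⋯ f (Y n)` for the chain `Y` with transition
kernel `Q` started at `x`. -/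
noncomputable def kernelMGF (Q : Kernel X X) (f : X → ℝ) : ℕ → X → ℝ
  | 0 => fun _ => 1
  | n + 1 => fun x => ∫ y, f y * kernelMGF Q f n y ∂Q x

theorem measurable_kernelMGF (Q : Kernel X X) {f : X → ℝ} (hf : Measurable f) (n : ℕ) :
    Measurable (kernelMGF Q f n) := by
  induction n with
  | zero => exact measurable_const
  | succ n ih => exact ((hf.mul ih).stronglyMeasurable.integral_kernel (κ := Q)).measurable

theorem kernelMGF_nonneg (Q : Kernel X X) {f : X → ℝ} (hf : ∀ x, 0 ≤ f x) (n : ℕ) (x : X) :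
    0 ≤ kernelMGF Q f n x := by
  induction n generalizing x with
  | zero => exact zero_le_one
  | succ n ih => exact integral_nonneg fun y => mul_nonneg (hf y) (ih y)

theorem integral_integral_of_invariant {Q : Kernel X X} [IsMarkovKernel Q] {ρ : Measure X}
    [IsProbabilityMeasure ρ] (hinv : Q.Invariant ρ) {φ : X → ℝ} (hφ : Measurable φ) {c : ℝ}
    (hc : ∀ x, |φ x| ≤ c) : ∫ x, ∫ y, φ y ∂Q x ∂ρ = ∫ x, φ x ∂ρ := by
  have hcomp : (Q ∘ₖ Kernel.const Unit ρ) () = ρ := by rw [Kernel.comp_const, hinv.def, Kernel.const_apply]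
  have h := Kernel.integral_comp (η := Q) (κ := Kernel.const Unit ρ) (a := ()) (f := φ)
    (by rw [hcomp]; exact hφ.integrable_of_abs_le hc)
  rwa [hcomp, Kernel.const_apply, eq_comm] at h

/-- Each step multiplies the moment generating function by at most `R`: the mean, the variance and
the oscillation around the mean are controlled simultaneously. -/
theorem kernelMGF_bounds {Q : Kernel X X} [IsMarkovKernel Q] {ρ : Measure X}
    [IsProbabilityMeasure ρ] (hinv : Q.Invariant ρ)
    (hTV : ∀ x B, MeasurableSet B → |(Q x).real B - ρ.real B| ≤ 1 / 64)
    {f : X → ℝ} (hf : Measurable f) (hf0 : ∀ x, 0 ≤ f x) (hf2 : ∀ x, f x ≤ 2)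
    {v R : ℝ} (hv : ∫ x, (f x - 1) ^ 2 ∂ρ ≤ v) (hR1 : 1 ≤ R) (hR : ∫ x, f x ∂ρ + v ≤ R) (n : ℕ) :
    ∫ x, kernelMGF Q f n x ∂ρ ≤ R ^ n ∧
    ∫ x, (kernelMGF Q f n x - ∫ y, kernelMGF Q f n y ∂ρ) ^ 2 ∂ρ ≤ v * (R ^ n) ^ 2 ∧
    ∀ x, |kernelMGF Q f n x - ∫ y, kernelMGF Q f n y ∂ρ| ≤ R ^ n := by
  have hv0 : 0 ≤ v := (integral_nonneg fun x => sq_nonneg _).trans hv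
  induction n with
  | zero => simp [kernelMGF, hv0]
  | succ n ih =>
    obtain ⟨ih1, ih2, ih3⟩ := ih
    set A := R ^ n with hA
    have hA1 : 1 ≤ A := one_le_pow₀ hR1
    set u := kernelMGF Q f n with hu
    set a := ∫ y, u y ∂ρ with ha
    have hum : Measurable u := measurable_kernelMGF Q hf n
    have hu0 : ∀ x, 0 ≤ u x := kernelMGF_nonneg Q hf0 n
    have ha0 : 0 ≤ a := integral_nonneg hu0
    have hu2 : ∀ x, u x ≤ 2 * A := fun x => by have := (abs_le.1 (ih3 x)).2; linarith
    have hfu : Measurable fun x => f x * u x := hf.mul hum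
    have hfub : ∀ x, |f x * u x| ≤ 4 * A := fun x => by
      rw [abs_of_nonneg (mul_nonneg (hf0 x) (hu0 x))]
      have := mul_le_mul (hf2 x) (hu2 x) (hu0 x) (by norm_num)
      linarith
    have hufin : ∀ x, kernelMGF Q f (n + 1) x = ∫ y, f y * u y ∂Q x := fun x => rfl
    have hmean : ∫ x, kernelMGF Q f (n + 1) x ∂ρ = ∫ x, f x * u x ∂ρ := by
      simp_rw [hufin]
      exact integral_integral_of_invariant hinv hfu hfub
    have hRA : A ≤ R ^ (n + 1) := by rw [pow_succ]; nlinarith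
    have hfi : Integrable f ρ := hf.integrable_of_abs_le (c := 2) fun x => by
      rw [abs_of_nonneg (hf0 x)]; exact hf2 x
    have hf1b : ∀ x, |f x - 1| ≤ 1 := fun x => by
      rw [abs_le]; constructor <;> linarith [hf0 x, hf2 x]
    have hwm : Measurable fun x => u x - a := hum.sub_const _
    have hui : Integrable u ρ := hum.integrable_of_abs_le (c := 2 * A) fun x => by
      rw [abs_of_nonneg (hu0 x)]; exact hu2 x
    have hf1i : Integrable (fun x => (f x - 1) ^ 2) ρ :=
      ((hf.sub_const 1).pow_const 2).integrable_of_abs_le (c := 1) fun x => by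
        rw [abs_pow]; exact pow_le_one₀ (abs_nonneg _) (hf1b x)
    have hw2i : Integrable (fun x => (u x - a) ^ 2) ρ :=
      (hwm.pow_const 2).integrable_of_abs_le (c := A ^ 2) fun x => by
        rw [abs_pow]; exact pow_le_pow_left₀ (abs_nonneg _) (ih3 x) 2
    have hcross : Integrable (fun x => (f x - 1) * (u x - a)) ρ :=
      ((hf.sub_const 1).mul hwm).integrable_of_abs_le (c := A) fun x => by
        show |(f x - 1) * (u x - a)| ≤ A
        rw [abs_mul]
        calc |f x - 1| * |u x - a| ≤ 1 * A :=
              mul_le_mul (hf1b x) (ih3 x) (abs_nonneg _) zero_le_one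
          _ = A := one_mul A
    have hRn : R ^ (n + 1) = R * A := by rw [pow_succ, mul_comm]
    refine ⟨?_, ?_, ?_⟩
    -- Mean: since `u - a` is centered, `f` may be replaced by `f - 1` in the fluctuation term.
    -- Weighted AM-GM then bounds that term by `v A`, so the total is at most `(∫ f + v) A ≤ R A`.
    · have hsplit : ∫ x, f x * u x ∂ρ = a * ∫ x, f x ∂ρ + ∫ x, (f x - 1) * (u x - a) ∂ρ := by
        have : ∀ x, f x * u x = (a * f x + (f x - 1) * (u x - a)) + (u x - a) := fun x => by ring
        simp_rw [this]
        have i1 : Integrable (fun x => a * f x) ρ := hfi.const_mul a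
        have i2 : Integrable (fun x => a * f x + (f x - 1) * (u x - a)) ρ := i1.add hcross
        have i3 : Integrable (fun x => u x - a) ρ := hui.sub (integrable_const a)
        rw [integral_add i2 i3, integral_add i1 hcross,
          integral_sub hui (integrable_const a), integral_const_mul]
        simp [ha]
      have hc : ∫ x, (f x - 1) * (u x - a) ∂ρ ≤ v * A := by
        calc ∫ x, (f x - 1) * (u x - a) ∂ρ
            ≤ ∫ x, ((A / 2) * (f x - 1) ^ 2 + (1 / (2 * A)) * (u x - a) ^ 2) ∂ρ := by
              apply integral_mono hcross ((hf1i.const_mul _).add (hw2i.const_mul _))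
              intro x
              have : (A / 2) * (f x - 1) ^ 2 + (1 / (2 * A)) * (u x - a) ^ 2
                  - (f x - 1) * (u x - a) = (A * (f x - 1) - (u x - a)) ^ 2 / (2 * A) := by
                field_simp
                ring
              have h2 : 0 ≤ (A * (f x - 1) - (u x - a)) ^ 2 / (2 * A) := by positivity
              show (f x - 1) * (u x - a) ≤ A / 2 * (f x - 1) ^ 2 + 1 / (2 * A) * (u x - a) ^ 2
              linarith
          _ = (A / 2) * ∫ x, (f x - 1) ^ 2 ∂ρ + (1 / (2 * A)) * ∫ x, (u x - a) ^ 2 ∂ρ := by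
              rw [integral_add (hf1i.const_mul _) (hw2i.const_mul _), integral_const_mul,
                integral_const_mul]
          _ ≤ (A / 2) * v + (1 / (2 * A)) * (v * A ^ 2) := by gcongr
          _ = v * A := by field_simp; ring
      rw [hmean, hsplit, hRn]
      have hf' : 0 ≤ ∫ x, f x ∂ρ := integral_nonneg hf0
      nlinarith [mul_le_mul_of_nonneg_right ih1 hf']
    -- Variance: closeness `1/64` of `Q x` and `ρ`, averaged over the invariant law, gives the
    -- factor `1/16`. Since `∫ ψ²` is at most `10 v A²`, the new variance stays below `v A²`.
    · rw [hmean]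
      set ψ : X → ℝ := fun x => f x * u x - a with hψ
      have hψm : Measurable ψ := hfu.sub_const a
      have hψb : ∀ x, |ψ x| ≤ 4 * A + a := fun x => by
        calc |f x * u x - a| ≤ |f x * u x| + |a| := abs_sub _ _
          _ ≤ 4 * A + a := by rw [abs_of_nonneg ha0]; gcongr; exact hfub x
      have hψ2b : ∀ x, |ψ x ^ 2| ≤ (4 * A + a) ^ 2 := fun x => by
        rw [abs_pow]; exact pow_le_pow_left₀ (abs_nonneg _) (hψb x) 2
      have hdiff : ∀ x, kernelMGF Q f (n + 1) x - ∫ y, f y * u y ∂ρ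
          = ∫ y, ψ y ∂Q x - ∫ y, ψ y ∂ρ := by
        intro x
        rw [hufin, hψ, integral_sub (hfu.integrable_of_abs_le hfub) (integrable_const a),
          integral_sub (hfu.integrable_of_abs_le hfub) (integrable_const a)]
        simp
      have hψ2 : Measurable fun x => ψ x ^ 2 := hψm.pow_const 2
      have hQψ : Integrable (fun x => ∫ y, ψ y ^ 2 ∂Q x) ρ :=
        ((hψ2.stronglyMeasurable.integral_kernel (κ := Q)).measurable).integrable_of_abs_le
          (c := (4 * A + a) ^ 2) fun x => by
            have := norm_integral_le_of_norm_le_const (μ := Q x)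
              (f := fun y => ψ y ^ 2) (Filter.Eventually.of_forall hψ2b)
            simpa using this
      have h1 : ∫ x, (kernelMGF Q f (n + 1) x - ∫ y, f y * u y ∂ρ) ^ 2 ∂ρ
          ≤ ∫ x, (1 / 32) * (∫ y, ψ y ^ 2 ∂Q x + ∫ y, ψ y ^ 2 ∂ρ) ∂ρ := by
        apply integral_mono_of_nonneg
        · exact Filter.Eventually.of_forall fun x => sq_nonneg _
        · exact (hQψ.add (integrable_const _)).const_mul _
        · refine Filter.Eventually.of_forall fun x => ?_
          have := sq_integral_sub_integral_le (Q x) ρ (hTV x) hψm hψb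
          simp only [hdiff]
          linarith
      have h2 : ∫ x, (1 / 32) * (∫ y, ψ y ^ 2 ∂Q x + ∫ y, ψ y ^ 2 ∂ρ) ∂ρ
          = (1 / 16) * ∫ y, ψ y ^ 2 ∂ρ := by
        rw [integral_const_mul, integral_add hQψ (integrable_const _),
          integral_integral_of_invariant hinv hψ2 hψ2b]
        simp only [integral_const, probReal_univ, smul_eq_mul]
        ring
      have h3 : ∫ y, ψ y ^ 2 ∂ρ ≤ 2 * a ^ 2 * v + 8 * (v * A ^ 2) := by
        calc ∫ y, ψ y ^ 2 ∂ρ ≤ ∫ y, (2 * a ^ 2 * (f y - 1) ^ 2 + 8 * (u y - a) ^ 2) ∂ρ := by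
              apply integral_mono (hψ2.integrable_of_abs_le hψ2b)
                ((hf1i.const_mul _).add (hw2i.const_mul _))
              intro y
              have e : ψ y = a * (f y - 1) + f y * (u y - a) := by simp only [hψ]; ring
              have hf4 : f y ^ 2 ≤ 4 := by nlinarith [hf0 y, hf2 y]
              have := mul_le_mul_of_nonneg_right hf4 (sq_nonneg (u y - a))
              show ψ y ^ 2 ≤ 2 * a ^ 2 * (f y - 1) ^ 2 + 8 * (u y - a) ^ 2
              rw [e]
              nlinarith [sq_nonneg (a * (f y - 1) - f y * (u y - a))]
          _ = 2 * a ^ 2 * ∫ y, (f y - 1) ^ 2 ∂ρ + 8 * ∫ y, (u y - a) ^ 2 ∂ρ := by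
              rw [integral_add (hf1i.const_mul _) (hw2i.const_mul _), integral_const_mul,
                integral_const_mul]
          _ ≤ _ := by gcongr
      have h4 : a ^ 2 ≤ A ^ 2 := pow_le_pow_left₀ ha0 ih1 2
      have h5 : v * A ^ 2 ≤ v * (R ^ (n + 1)) ^ 2 := by gcongr
      have h6 : v * a ^ 2 ≤ v * A ^ 2 := by gcongr
      rw [h2] at h1
      nlinarith [mul_nonneg hv0 (sq_nonneg A)]
    · intro x
      rw [hmean, hufin]
      -- Oscillation: `2 · (1/64) · 4 A = A / 8`.
      refine (abs_integral_sub_integral_le (Q x) ρ (hTV x) hfu (by positivity) hfub).trans ?_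
      linarith

theorem kernelMGF_le {Q : Kernel X X} [IsMarkovKernel Q] {ρ : Measure X}
    [IsProbabilityMeasure ρ] (hinv : Q.Invariant ρ)
    (hTV : ∀ x B, MeasurableSet B → |(Q x).real B - ρ.real B| ≤ 1 / 64)
    {f : X → ℝ} (hf : Measurable f) (hf0 : ∀ x, 0 ≤ f x) (hf2 : ∀ x, f x ≤ 2)
    {v R : ℝ} (hv : ∫ x, (f x - 1) ^ 2 ∂ρ ≤ v) (hR1 : 1 ≤ R) (hR : ∫ x, f x ∂ρ + v ≤ R) (n : ℕ)
    (x : X) : kernelMGF Q f n x ≤ 2 * R ^ n := by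
  obtain ⟨h1, -, h3⟩ := kernelMGF_bounds hinv hTV hf hf0 hf2 hv hR1 hR n
  have := (abs_le.1 (h3 x)).2
  linarith

/-- The moment generating function of a centered function `g` with `|g| ≤ 1 / 2`. -/
theorem kernelMGF_exp_le {Q : Kernel X X} [IsMarkovKernel Q] {ρ : Measure X}
    [IsProbabilityMeasure ρ] (hinv : Q.Invariant ρ)
    (hTV : ∀ x B, MeasurableSet B → |(Q x).real B - ρ.real B| ≤ 1 / 64)
    {g : X → ℝ} (hg : Measurable g) (hgb : ∀ x, |g x| ≤ 1 / 2) (hg0 : ∫ x, g x ∂ρ = 0)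
    {V : ℝ} (hV : ∫ x, g x ^ 2 ∂ρ ≤ V) (n : ℕ) (x : X) :
    kernelMGF Q (fun y => Real.exp (g y)) n x ≤ 2 * (1 + 5 * V) ^ n := by
  have hV0 : 0 ≤ V := (integral_nonneg fun x => sq_nonneg _).trans hV
  have hgi : Integrable g ρ := hg.integrable_of_abs_le hgb
  have hg2b : ∀ x, |g x ^ 2| ≤ (1 / 2) ^ 2 := fun x => by
    rw [abs_pow]; exact pow_le_pow_left₀ (abs_nonneg _) (hgb x) 2
  have hg2i : Integrable (fun x => g x ^ 2) ρ := (hg.pow_const 2).integrable_of_abs_le hg2b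
  have h1 : ∀ x, |Real.exp (g x) - 1| ≤ 2 * |g x| := fun x =>
    Real.abs_exp_sub_one_le ((hgb x).trans (by norm_num))
  have h2 : ∀ x, Real.exp (g x) ≤ 2 := fun x => by
    linarith [(abs_le.1 (h1 x)).2, hgb x]
  have hem : Measurable fun y => Real.exp (g y) := hg.exp
  have hei : Integrable (fun y => Real.exp (g y)) ρ := hem.integrable_of_abs_le (c := 2) fun x => by
    rw [Real.abs_exp]; exact h2 x
  -- The `5` in `1 + 5 V` is `1 + 4`: the mean of `exp g` is at most `1 + V` since `g` is centered,
  -- and `|exp g - 1| ≤ 2 |g|` gives `v = 4 V`.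
  refine kernelMGF_le hinv hTV hem (fun y => (Real.exp_pos _).le) h2 (v := 4 * V) ?_ (by linarith)
    ?_ n x
  · calc ∫ x, (Real.exp (g x) - 1) ^ 2 ∂ρ ≤ ∫ x, 4 * g x ^ 2 ∂ρ := by
          apply integral_mono_of_nonneg (Filter.Eventually.of_forall fun x => sq_nonneg _)
            (hg2i.const_mul 4)
          refine Filter.Eventually.of_forall fun x => ?_
          have := pow_le_pow_left₀ (abs_nonneg _) (h1 x) 2
          rw [sq_abs, mul_pow, sq_abs] at this
          show (Real.exp (g x) - 1) ^ 2 ≤ 4 * g x ^ 2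
          linarith
      _ ≤ 4 * V := by rw [integral_const_mul]; linarith
  · have : ∫ x, Real.exp (g x) ∂ρ ≤ ∫ x, (1 + g x + g x ^ 2) ∂ρ := by
      apply integral_mono hei (((integrable_const 1).add hgi).add hg2i)
      intro x
      have := Real.abs_exp_sub_one_sub_id_le ((hgb x).trans (by norm_num))
      show Real.exp (g x) ≤ 1 + g x + g x ^ 2
      linarith [(abs_le.1 this).2]
    have i1 : Integrable (fun x => 1 + g x) ρ := (integrable_const 1).add hgi
    rw [integral_add i1 hg2i, integral_add (integrable_const 1) hgi, hg0] at this
    simp at this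
    linarith

end MomentGeneratingFunction

/-! ### Bernstein inequality for the Markov chain -/

section MarkovChainDeviation

variable {Ω X : Type*} [MeasurableSpace Ω] [MeasurableSpace X]

theorem isMarkovKernel_pow (K : Kernel X X) [IsMarkovKernel K] (m : ℕ) :
    IsMarkovKernel (K ^ m) := by
  induction m with
  | zero => rw [pow_zero]; exact inferInstanceAs (IsMarkovKernel Kernel.id)
  | succ m ih => rw [Kernel.pow_add, pow_one]; infer_instance

theorem invariant_pow {K : Kernel X X} {ρ : Measure X} (h : K.Invariant ρ) (m : ℕ) :
    (K ^ m).Invariant ρ := by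
  induction m with
  | zero => rw [pow_zero]; exact Measure.id_comp
  | succ m ih => rw [Kernel.pow_add, pow_one]; exact ih.comp h

theorem IsMarkovChain.lintegral_succ {μ : Measure Ω} [IsProbabilityMeasure μ] {K : Kernel X X}
    [IsMarkovKernel K] {N : ℕ} {Z : ℕ → Ω → X} (hZ : IsMarkovChain μ K N Z) {t : ℕ}
    (ht : t + 1 < N) {φ : X → ℝ≥0∞} (hφ : Measurable φ) {Ψ : (Fin (t + 1) → X) → ℝ≥0∞}
    (hΨ : Measurable Ψ) :
    ∫⁻ ω, φ (Z (t + 1) ω) * Ψ (fun i => Z i ω) ∂μ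
      = ∫⁻ ω, (∫⁻ y, φ y ∂K (Z t ω)) * Ψ (fun i => Z i ω) ∂μ := by
  have hpast : Measurable fun ω => (fun i : Fin (t + 1) => Z i ω) :=
    measurable_pi_lambda _ fun i => hZ.measurable i (by have := i.2; omega)
  have hpair : Measurable fun ω => ((fun i : Fin (t + 1) => Z i ω), Z (t + 1) ω) :=
    hpast.prodMk (hZ.measurable _ ht)
  have hprod : Measurable fun p : (Fin (t + 1) → X) × X => φ p.2 * Ψ p.1 :=
    (hφ.comp measurable_snd).mul (hΨ.comp measurable_fst)
  have hK : Measurable fun x => ∫⁻ y, φ y ∂K x := hφ.lintegral_kernel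
  have : IsProbabilityMeasure (μ.map fun ω => (fun i : Fin (t + 1) => Z i ω)) :=
    Measure.isProbabilityMeasure_map hpast.aemeasurable
  calc ∫⁻ ω, φ (Z (t + 1) ω) * Ψ (fun i => Z i ω) ∂μ
      = ∫⁻ p, φ p.2 * Ψ p.1 ∂(μ.map fun ω => ((fun i : Fin (t + 1) => Z i ω), Z (t + 1) ω)) := by
        rw [lintegral_map hprod hpair]
    _ = ∫⁻ z, ∫⁻ y, φ y * Ψ z ∂K (z (Fin.last t)) ∂(μ.map fun ω => (fun i : Fin (t + 1) => Z i ω)) := by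
        rw [hZ.step t ht, Measure.lintegral_compProd hprod]
        rfl
    _ = ∫⁻ z, (∫⁻ y, φ y ∂K (z (Fin.last t))) * Ψ z ∂(μ.map fun ω => (fun i : Fin (t + 1) => Z i ω)) := by
        simp_rw [lintegral_mul_const _ hφ]
    _ = _ := by
        have hm : Measurable fun z : Fin (t + 1) → X =>
            (∫⁻ y, φ y ∂K (z (Fin.last t))) * Ψ z :=
          (hK.comp (measurable_pi_apply _)).mul hΨ
        rw [lintegral_map hm hpast]
        rfl

theorem IsMarkovChain.lintegral_add {μ : Measure Ω} [IsProbabilityMeasure μ] {K : Kernel X X}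
    [IsMarkovKernel K] {N : ℕ} {Z : ℕ → Ω → X} (hZ : IsMarkovChain μ K N Z) {t : ℕ} (m : ℕ)
    (ht : t + m < N) {φ : X → ℝ≥0∞} (hφ : Measurable φ) {Ψ : (Fin (t + 1) → X) → ℝ≥0∞}
    (hΨ : Measurable Ψ) :
    ∫⁻ ω, φ (Z (t + m) ω) * Ψ (fun i => Z i ω) ∂μ
      = ∫⁻ ω, (∫⁻ y, φ y ∂(K ^ m) (Z t ω)) * Ψ (fun i => Z i ω) ∂μ := by
  induction m generalizing φ with
  | zero =>
    have : ∀ x, ∫⁻ y, φ y ∂(K ^ 0) x = φ x := fun x => by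
      rw [pow_zero]
      exact (congrArg (fun κ : Measure X => ∫⁻ y, φ y ∂κ) (Kernel.id_apply x)).trans
        (lintegral_dirac' x hφ)
    simp_rw [this]
    rfl
  | succ m ih =>
    have h := hZ.lintegral_succ (t := t + m) (by omega) hφ
      (Ψ := fun z => Ψ fun i => z (i.castLE (by omega)))
      (hΨ.comp (measurable_pi_lambda _ fun i => measurable_pi_apply _))
    have h2 := ih (by omega) (φ := fun x => ∫⁻ y, φ y ∂K x) hφ.lintegral_kernel
    have hpow : ∀ x, ∫⁻ y, φ y ∂(K ^ (m + 1)) x = ∫⁻ z, ∫⁻ y, φ y ∂K z ∂(K ^ m) x := fun x => by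
      rw [add_comm, Kernel.pow_add, pow_one, Kernel.lintegral_comp _ _ _ hφ]
    simp_rw [hpow]
    rw [← h2]
    exact h

/-- Integrating out the latest points one at a time, `U n` stands for the contribution of the last
`n` of them. The number `J` of earlier steps varies in the induction. -/
theorem IsMarkovChain.lintegral_prod_skeleton {μ : Measure Ω} [IsProbabilityMeasure μ]
    {K : Kernel X X} [IsMarkovKernel K] {N : ℕ} {Z : ℕ → Ω → X} (hZ : IsMarkovChain μ K N Z)
    (m r : ℕ) {F : X → ℝ≥0∞} (hF : Measurable F) {U : ℕ → X → ℝ≥0∞} (hU : ∀ n, Measurable (U n))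
    (hU0 : ∀ x, U 0 x = 1) (hU1 : ∀ n x, U (n + 1) x = ∫⁻ y, F y * U n y ∂(K ^ m) x)
    (n J : ℕ) (hn : r + (J + n) * m < N) :
    ∫⁻ ω, ∏ i ∈ Finset.range (J + n + 1), F (Z (r + i * m) ω) ∂μ
      = ∫⁻ ω, U n (Z (r + J * m) ω) * ∏ i ∈ Finset.range (J + 1), F (Z (r + i * m) ω) ∂μ := by
  induction n generalizing J with
  | zero => simp [hU0]
  | succ n ih =>
    have h1 := ih (J + 1) (by rw [show J + 1 + n = J + (n + 1) by ring]; exact hn)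
    rw [show J + 1 + n + 1 = J + (n + 1) + 1 by ring] at h1
    have hlt : r + J * m + m < N := by
      refine lt_of_le_of_lt ?_ hn
      have : (J + (n + 1)) * m = J * m + m + n * m := by ring
      omega
    have h2 := hZ.lintegral_add (t := r + J * m) m hlt (φ := fun y => F y * U n y)
      (hF.mul (hU n))
      (Ψ := fun z => ∏ i : Fin (J + 1), F (z ⟨r + i * m, by
        have := Nat.mul_le_mul_right m (Nat.lt_succ_iff.1 i.2); omega⟩))
      (Finset.measurable_prod _ fun i _ => hF.comp (measurable_pi_apply _))
    have h3 : ∀ ω, ∏ i : Fin (J + 1), F (Z (r + i * m) ω)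
        = ∏ i ∈ Finset.range (J + 1), F (Z (r + i * m) ω) := fun ω =>
      (Finset.prod_range fun i => F (Z (r + i * m) ω)).symm
    simp only [h3, ← hU1] at h2
    rw [h1, ← h2]
    refine lintegral_congr fun ω => ?_
    rw [Finset.prod_range_succ _ (J + 1), show r + (J + 1) * m = r + J * m + m by ring]
    ring

theorem sum_range_interleave {M : Type*} [AddCommMonoid M] (h : ℕ → M) (m k l : ℕ) (hl : l ≤ m) :
    ∑ t ∈ Finset.range (k * m + l), h t
      = ∑ r ∈ Finset.range m, ∑ j ∈ Finset.range (if r < l then k + 1 else k), h (r + j * m) := by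
  have h1 : ∀ k, ∑ t ∈ Finset.range (k * m), h t
      = ∑ r ∈ Finset.range m, ∑ j ∈ Finset.range k, h (r + j * m) := by
    intro k
    induction k with
    | zero => simp
    | succ k ih =>
      rw [Nat.succ_mul, Finset.sum_range_add, ih, ← Finset.sum_add_distrib]
      refine Finset.sum_congr rfl fun r _ => ?_
      rw [Finset.sum_range_succ, add_comm r]
  have h2 : ∀ r, ∑ j ∈ Finset.range (if r < l then k + 1 else k), h (r + j * m)
      = ∑ j ∈ Finset.range k, h (r + j * m) + if r < l then h (k * m + r) else 0 := by
    intro r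
    split_ifs
    · rw [Finset.sum_range_succ, add_comm r (k * m)]
    · rw [add_zero]
  simp_rw [h2]
  rw [Finset.sum_range_add, h1, Finset.sum_add_distrib, ← Finset.sum_filter]
  congr 1
  refine Finset.sum_congr ?_ fun _ _ => rfl
  ext r
  simp only [Finset.mem_range, Finset.mem_filter]
  omega

/-- A crude bound, used only for integrability in the recursion. -/
theorem kernelMGF_le_two_pow (Q : Kernel X X) [IsMarkovKernel Q] {f : X → ℝ}
    (hf0 : ∀ x, 0 ≤ f x) (hf2 : ∀ x, f x ≤ 2) (n : ℕ) (x : X) : kernelMGF Q f n x ≤ 2 ^ n := by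
  induction n generalizing x with
  | zero => simp [kernelMGF]
  | succ n ih =>
    have h : ∀ y, ‖f y * kernelMGF Q f n y‖ ≤ 2 ^ (n + 1) := fun y => by
      rw [Real.norm_of_nonneg (mul_nonneg (hf0 y) (kernelMGF_nonneg Q hf0 n y)), pow_succ, mul_comm]
      exact mul_le_mul (ih y) (hf2 y) (hf0 y) (by positivity)
    have := norm_integral_le_of_norm_le_const (μ := Q x) (Filter.Eventually.of_forall h)
    rw [probReal_univ, mul_one] at this
    exact (le_abs_self _).trans this

theorem IsMarkovChain.lintegral_exp_skeleton_le {μ : Measure Ω} [IsProbabilityMeasure μ]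
    {K : Kernel X X} [IsMarkovKernel K] {N : ℕ} {Z : ℕ → Ω → X} (hZ : IsMarkovChain μ K N Z)
    {m : ℕ} {ρ : Measure X} [IsProbabilityMeasure ρ] (hinv : K.Invariant ρ)
    (hTV : ∀ x B, MeasurableSet B → |((K ^ m) x).real B - ρ.real B| ≤ 1 / 64)
    {g : X → ℝ} (hg : Measurable g) (hgb : ∀ x, |g x| ≤ 1 / 2) (hg0 : ∫ x, g x ∂ρ = 0)
    {V : ℝ} (hV : ∫ x, g x ^ 2 ∂ρ ≤ V) {r n : ℕ} (hn : r + n * m < N) :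
    ∫⁻ ω, ENNReal.ofReal (Real.exp (∑ j ∈ Finset.range (n + 1), g (Z (r + j * m) ω))) ∂μ
      ≤ ENNReal.ofReal (4 * (1 + 5 * V) ^ n) := by
  have := isMarkovKernel_pow K m
  have hV0 : 0 ≤ V := (integral_nonneg fun x => sq_nonneg _).trans hV
  set f : X → ℝ := fun x => Real.exp (g x) with hf
  have hfm : Measurable f := hg.exp
  have hf0 : ∀ x, 0 ≤ f x := fun x => (Real.exp_pos _).le
  have hf2 : ∀ x, f x ≤ 2 := fun x => by
    have := Real.abs_exp_sub_one_le ((hgb x).trans (by norm_num))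
    simp only [hf]
    linarith [(abs_le.1 this).2, hgb x]
  have hU := hZ.lintegral_prod_skeleton m r (F := fun x => ENNReal.ofReal (f x)) hfm.ennreal_ofReal
    (U := fun n x => ENNReal.ofReal (kernelMGF (K ^ m) f n x))
    (fun n => (measurable_kernelMGF _ hfm n).ennreal_ofReal) (fun x => by simp [kernelMGF])
    (fun n x => by
      have hb : ∀ y, |f y * kernelMGF (K ^ m) f n y| ≤ 2 * 2 ^ n := fun y => by
        rw [abs_of_nonneg (mul_nonneg (hf0 y) (kernelMGF_nonneg _ hf0 n y))]
        exact mul_le_mul (hf2 y) (kernelMGF_le_two_pow _ hf0 hf2 n y) (kernelMGF_nonneg _ hf0 n y)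
          zero_le_two
      show ENNReal.ofReal (∫ y, f y * kernelMGF (K ^ m) f n y ∂(K ^ m) x) = _
      have hi : Integrable (fun y => f y * kernelMGF (K ^ m) f n y) ((K ^ m) x) :=
        (hfm.mul (measurable_kernelMGF _ hfm n)).integrable_of_abs_le hb
      rw [ofReal_integral_eq_lintegral_ofReal hi
        (Filter.Eventually.of_forall fun y => mul_nonneg (hf0 y) (kernelMGF_nonneg _ hf0 n y))]
      simp_rw [ENNReal.ofReal_mul (hf0 _)])
    n 0 (by simpa using hn)
  have hexp : ∀ ω, ENNReal.ofReal (Real.exp (∑ j ∈ Finset.range (n + 1), g (Z (r + j * m) ω)))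
      = ∏ i ∈ Finset.range (0 + n + 1), ENNReal.ofReal (f (Z (r + i * m) ω)) := fun ω => by
    rw [Real.exp_sum, ENNReal.ofReal_prod_of_nonneg fun i _ => (Real.exp_pos _).le, zero_add]
  simp_rw [hexp]
  rw [hU]
  calc _ ≤ ∫⁻ ω, ENNReal.ofReal (4 * (1 + 5 * V) ^ n) ∂μ := by
        refine lintegral_mono fun ω => ?_
        rw [zero_add, Finset.prod_range_one, ← ENNReal.ofReal_mul (kernelMGF_nonneg _ hf0 n _)]
        apply ENNReal.ofReal_le_ofReal
        -- The first of the `n + 1` points has an arbitrary law and is bounded by `f ≤ 2`; the other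
        -- `n` are handled by the kernel.
        calc _ ≤ (2 * (1 + 5 * V) ^ n) * 2 := mul_le_mul
              (kernelMGF_exp_le (invariant_pow hinv m) hTV hg hgb hg0 hV n _) (hf2 _) (hf0 _)
              (by positivity)
          _ = _ := by ring
    _ = _ := by simp

/-- The times split into `m` residue classes modulo `m`, each a skeleton with kernel `K ^ m`.
Convexity of `exp` bounds the exponential of the average of the class sums by the average of their
exponentials, so the dependence between classes plays no role. -/
theorem IsMarkovChain.lintegral_exp_sum_le {μ : Measure Ω} [IsProbabilityMeasure μ]
    {K : Kernel X X} [IsMarkovKernel K] {N : ℕ} {Z : ℕ → Ω → X} (hZ : IsMarkovChain μ K N Z)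
    {m : ℕ} (hm : 0 < m) {ρ : Measure X} [IsProbabilityMeasure ρ] (hinv : K.Invariant ρ)
    (hTV : ∀ x B, MeasurableSet B → |((K ^ m) x).real B - ρ.real B| ≤ 1 / 64)
    {g : X → ℝ} (hg : Measurable g) (hgb : ∀ x, |g x| ≤ 1 / 2) (hg0 : ∫ x, g x ∂ρ = 0)
    {V : ℝ} (hV : ∫ x, g x ^ 2 ∂ρ ≤ V) :
    ∫⁻ ω, ENNReal.ofReal (Real.exp ((1 / m) * ∑ t ∈ Finset.range N, g (Z t ω))) ∂μ
      ≤ ENNReal.ofReal (4 * Real.exp (5 * V * (N / m))) := by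
  have hV0 : 0 ≤ V := (integral_nonneg fun x => sq_nonneg _).trans hV
  have hm' : (0 : ℝ) < m := by exact_mod_cast hm
  set k := N / m with hk
  set l := N % m with hl
  have hN : k * m + l = N := Nat.div_add_mod' N m
  have hlm : l < m := Nat.mod_lt _ hm
  set c : ℕ → ℕ := fun r => if r < l then k + 1 else k with hc
  have hR1 : 1 ≤ 1 + 5 * V := by linarith
  have hkN : (k : ℝ) ≤ N / m := Nat.cast_div_le
  have hRk : (1 + 5 * V) ^ k ≤ Real.exp (5 * V * (N / m)) := by
    calc (1 + 5 * V) ^ k ≤ (Real.exp (5 * V)) ^ k := by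
          apply pow_le_pow_left₀ (by linarith)
          linarith [Real.add_one_le_exp (5 * V)]
      _ = Real.exp (k * (5 * V)) := (Real.exp_nat_mul _ _).symm
      _ ≤ _ := by
          apply Real.exp_le_exp.2
          rw [mul_comm]
          gcongr
  have hres : ∀ r < m,
      ∫⁻ ω, ENNReal.ofReal (Real.exp (∑ j ∈ Finset.range (c r), g (Z (r + j * m) ω))) ∂μ
        ≤ ENNReal.ofReal (4 * Real.exp (5 * V * (N / m))) := by
    intro r hr
    -- A class is empty when `N < m` and `r ≥ N`. Otherwise it has at most `k + 1` points, the first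
    -- of which costs no power of `1 + 5 V`.
    rcases Nat.eq_zero_or_pos (c r) with h0 | hpos
    · rw [h0]
      simp only [Finset.range_zero, Finset.sum_empty, Real.exp_zero, ENNReal.ofReal_one,
        lintegral_const, measure_univ, mul_one]
      rw [ENNReal.one_le_ofReal]
      have : 1 ≤ Real.exp (5 * V * (N / m)) := Real.one_le_exp (by positivity)
      linarith
    · obtain ⟨n, hn⟩ := Nat.exists_eq_succ_of_ne_zero hpos.ne'
      have hnk : n ≤ k := by
        simp only [hc] at hn
        split_ifs at hn <;> omega
      have hlt : r + n * m < N := by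
        simp only [hc] at hn
        split_ifs at hn with h
        · have : n = k := by omega
          rw [this]; omega
        · have : k * m = n * m + m := by rw [hn, Nat.succ_mul]
          omega
      rw [hn]
      refine (hZ.lintegral_exp_skeleton_le hinv hTV hg hgb hg0 hV hlt).trans ?_
      apply ENNReal.ofReal_le_ofReal
      have := pow_le_pow_right₀ hR1 hnk
      linarith
  have hjensen : ∀ ω, Real.exp ((1 / m) * ∑ t ∈ Finset.range N, g (Z t ω))
      ≤ ∑ r ∈ Finset.range m, (1 / m : ℝ) *
          Real.exp (∑ j ∈ Finset.range (c r), g (Z (r + j * m) ω)) := by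
    intro ω
    have h := convexOn_exp.map_sum_le (t := Finset.range m) (w := fun _ => (1 / m : ℝ))
      (p := fun r => ∑ j ∈ Finset.range (c r), g (Z (r + j * m) ω)) (fun _ _ => by positivity)
      (by simp [hm'.ne']) (fun _ _ => Set.mem_univ _)
    simp only [smul_eq_mul] at h
    rw [← Finset.mul_sum, ← sum_range_interleave (fun t => g (Z t ω)) m k l hlm.le, hN] at h
    exact h
  have hmeas : ∀ r ∈ Finset.range m, Measurable fun ω => ENNReal.ofReal ((1 / m : ℝ) *
      Real.exp (∑ j ∈ Finset.range (c r), g (Z (r + j * m) ω))) := by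
    intro r hr
    have hr := Finset.mem_range.1 hr
    refine ((Finset.measurable_sum _ fun j hj => ?_).exp.const_mul _).ennreal_ofReal
    refine hg.comp (hZ.measurable _ ?_)
    have hj := Finset.mem_range.1 hj
    simp only [hc] at hj
    split_ifs at hj with h
    · have := Nat.mul_le_mul_right m (Nat.lt_succ_iff.1 hj)
      omega
    · have := Nat.mul_le_mul_right m hj
      rw [Nat.succ_mul] at this
      omega
  calc ∫⁻ ω, ENNReal.ofReal (Real.exp ((1 / m) * ∑ t ∈ Finset.range N, g (Z t ω))) ∂μ
      ≤ ∫⁻ ω, ∑ r ∈ Finset.range m, ENNReal.ofReal ((1 / m : ℝ) *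
          Real.exp (∑ j ∈ Finset.range (c r), g (Z (r + j * m) ω))) ∂μ := by
        refine lintegral_mono fun ω => ?_
        rw [← ENNReal.ofReal_sum_of_nonneg fun r _ => by positivity]
        exact ENNReal.ofReal_le_ofReal (hjensen ω)
    _ = ∑ r ∈ Finset.range m, ENNReal.ofReal (1 / m : ℝ) *
          ∫⁻ ω, ENNReal.ofReal (Real.exp (∑ j ∈ Finset.range (c r), g (Z (r + j * m) ω))) ∂μ := by
        rw [lintegral_finsetSum _ hmeas]
        refine Finset.sum_congr rfl fun r _ => ?_
        rw [← lintegral_const_mul' _ _ ENNReal.ofReal_ne_top]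
        refine lintegral_congr fun ω => ?_
        rw [ENNReal.ofReal_mul (by positivity)]
    _ ≤ ∑ r ∈ Finset.range m, ENNReal.ofReal (1 / m : ℝ) *
          ENNReal.ofReal (4 * Real.exp (5 * V * (N / m))) := by
        refine Finset.sum_le_sum fun r hr => ?_
        gcongr
        exact hres r (Finset.mem_range.1 hr)
    _ = ENNReal.ofReal (4 * Real.exp (5 * V * (N / m))) := by
        rw [← Finset.sum_mul, ← ENNReal.ofReal_sum_of_nonneg fun r _ => by positivity]
        simp [hm'.ne']

/-- A Bernstein-type deviation bound for a uniformly ergodic Markov chain with arbitrary initial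
law. -/
theorem IsMarkovChain.measure_sum_ge_le {μ : Measure Ω} [IsProbabilityMeasure μ]
    {K : Kernel X X} [IsMarkovKernel K] {N : ℕ} {Z : ℕ → Ω → X} (hZ : IsMarkovChain μ K N Z)
    {m : ℕ} (hm : 0 < m) {ρ : Measure X} [IsProbabilityMeasure ρ] (hinv : K.Invariant ρ)
    (hTV : ∀ x B, MeasurableSet B → |((K ^ m) x).real B - ρ.real B| ≤ 1 / 64)
    {g : X → ℝ} (hg : Measurable g) {b : ℝ} (hgb : ∀ x, |g x| ≤ b) (hg0 : ∫ x, g x ∂ρ = 0)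
    {V : ℝ} (hV : ∫ x, g x ^ 2 ∂ρ ≤ V) {s : ℝ} (hs : 0 < s) (hsb : s * b ≤ 1 / 2) (x : ℝ) :
    μ {ω | 5 * s * V * N + m * x / s ≤ ∑ t ∈ Finset.range N, g (Z t ω)}
      ≤ ENNReal.ofReal (4 * Real.exp (-x)) := by
  have hm' : (0 : ℝ) < m := by exact_mod_cast hm
  have hmgf := hZ.lintegral_exp_sum_le hm hinv hTV (g := fun y => s * g y) (hg.const_mul s)
    (fun y => by
      rw [abs_mul, abs_of_pos hs]
      exact (mul_le_mul_of_nonneg_left (hgb y) hs.le).trans hsb)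
    (by rw [integral_const_mul, hg0, mul_zero]) (V := s ^ 2 * V)
    (by simp_rw [mul_pow]; rw [integral_const_mul]; gcongr)
  set a : ℝ := 5 * (s ^ 2 * V) * (N / m) + x with ha
  have hsub : {ω | 5 * s * V * N + m * x / s ≤ ∑ t ∈ Finset.range N, g (Z t ω)} ⊆
      {ω | ENNReal.ofReal (Real.exp a) ≤
        ENNReal.ofReal (Real.exp ((1 / m) * ∑ t ∈ Finset.range N, s * g (Z t ω)))} := by
    intro ω hω
    apply ENNReal.ofReal_le_ofReal
    apply Real.exp_le_exp.2
    rw [← Finset.mul_sum]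
    have hω' : 5 * s * V * N + m * x / s ≤ ∑ t ∈ Finset.range N, g (Z t ω) := hω
    calc a = 1 / m * (s * (5 * s * V * N + m * x / s)) := by rw [ha]; field_simp
      _ ≤ _ := by gcongr
  have hmeas : Measurable fun ω =>
      ENNReal.ofReal (Real.exp ((1 / m) * ∑ t ∈ Finset.range N, s * g (Z t ω))) := by
    refine ((Finset.measurable_sum _ fun t ht => ?_).const_mul _).exp.ennreal_ofReal
    exact (hg.comp (hZ.measurable t (Finset.mem_range.1 ht))).const_mul s
  have hmarkov := mul_meas_ge_le_lintegral₀ hmeas.aemeasurable (μ := μ)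
    (ENNReal.ofReal (Real.exp a))
  have h := (mul_le_mul_right (measure_mono hsub) (ENNReal.ofReal (Real.exp a))).trans
    (hmarkov.trans hmgf)
  have hsplit : 4 * Real.exp (5 * (s ^ 2 * V) * (N / m))
      = Real.exp a * (4 * Real.exp (-x)) := by
    rw [mul_left_comm (Real.exp a), ← Real.exp_add, ha]
    congr 2
    ring
  rw [hsplit, ENNReal.ofReal_mul (Real.exp_pos _).le] at h
  exact (ENNReal.mul_le_mul_iff_right (by simp [Real.exp_pos]) ENNReal.ofReal_ne_top).1 h

end MarkovChainDeviation

/-! ### Pointwise Kullback-Leibler inequalities -/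

section KullbackLeibler

/-- The function `exp (-t) + t - 1` is quadratic near zero and for negative `t`, but only linear for
large `t`; the factor `L + 2` pays for the linear range `2 ≤ t ≤ L`. For `0 ≤ t ≤ 2` it is at least
`t² / 4`, from `exp (-t) ≥ (1 - t/2)²`. -/
theorem sq_le_mul_exp_neg_add_sub_one {t L : ℝ} (hL : 0 ≤ L) (ht : t ≤ L) :
    t ^ 2 ≤ 2 * (L + 2) * (Real.exp (-t) + t - 1) := by
  rcases le_total t 0 with h0 | h0
  · have := Real.quadratic_le_exp_of_nonneg (neg_nonneg.2 h0)
    nlinarith [sq_nonneg t]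
  · have hmono : 2 * (t + 2) * (Real.exp (-t) + t - 1)
        ≤ 2 * (L + 2) * (Real.exp (-t) + t - 1) := by
      have := Real.add_one_le_exp (-t)
      apply mul_le_mul_of_nonneg_right <;> linarith
    refine le_trans ?_ hmono
    rcases le_total t 2 with h2 | h2
    · have h1 : 1 - t / 2 ≤ Real.exp (-(t / 2)) := by
        linarith [Real.add_one_le_exp (-(t / 2))]
      have h3 : (1 - t / 2) ^ 2 ≤ Real.exp (-t) := by
        have : Real.exp (-t) = Real.exp (-(t / 2)) ^ 2 := by
          rw [← Real.exp_nat_mul]; congr 1; push_cast; ring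
        rw [this]
        exact pow_le_pow_left₀ (by linarith) h1 2
      nlinarith [mul_nonneg h0 (sq_nonneg t)]
    · nlinarith [Real.exp_pos (-t)]

/-- The previous inequality at `t = log p - log q`, where `p exp (-t) = q`. The extra `q - p`
vanishes on summing over actions; at `p = 0` the convention `Real.log 0 = 0` is harmless. -/
theorem mul_sq_log_sub_log_le {α p q : ℝ} (hα : 0 < α) (hα1 : α ≤ 1) (hp : 0 ≤ p) (hp1 : p ≤ 1)
    (hq : α ≤ q) :
    p * (Real.log p - Real.log q) ^ 2
      ≤ 2 * (Real.log (1 / α) + 2) * (p * (Real.log p - Real.log q) + q - p) := by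
  have hL : 0 ≤ Real.log (1 / α) := Real.log_nonneg (one_le_one_div hα hα1)
  have hq0 : 0 < q := hα.trans_le hq
  rcases hp.eq_or_lt with rfl | hp0
  · simp only [zero_mul, zero_add, sub_zero]
    positivity
  · have ht : Real.log p - Real.log q ≤ Real.log (1 / α) := by
      rw [one_div, Real.log_inv]
      have h1 := Real.log_nonpos hp hp1
      have h2 := Real.log_le_log hα hq
      linarith
    have h := mul_le_mul_of_nonneg_left (sq_le_mul_exp_neg_add_sub_one hL ht) hp
    have he : p * Real.exp (-(Real.log p - Real.log q)) = q := by
      rw [neg_sub, Real.exp_sub, Real.exp_log hp0, Real.exp_log hq0]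
      field_simp
    calc _ ≤ _ := h
      _ = 2 * (Real.log (1 / α) + 2) * (p * Real.exp (-(Real.log p - Real.log q))
            + p * (Real.log p - Real.log q) - p) := by ring
      _ = _ := by rw [he]; ring

theorem klDiv_eq_ofReal_integral_log_sub_log {A : Type*} [MeasurableSpace A] [Finite A]
    [MeasurableSingletonClass A] (p q : Measure A) [IsProbabilityMeasure p]
    [IsProbabilityMeasure q] (hq : ∀ a, 0 < q.real {a}) :
    InformationTheory.klDiv p q
      = ENNReal.ofReal (∫ a, (Real.log (p.real {a}) - Real.log (q.real {a})) ∂p) := by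
  have hac : p ≪ q := by
    intro s hs
    have : s = ∅ := by
      by_contra hne
      obtain ⟨a, ha⟩ := Set.nonempty_iff_ne_empty.2 hne
      have h0 : q {a} = 0 := measure_mono_null (Set.singleton_subset_iff.2 ha) hs
      exact (hq a).ne' (by simp [measureReal_def, h0])
    simp [this]
  have hllr : llr p q =ᵐ[p] fun a => Real.log (p.real {a}) - Real.log (q.real {a}) := by
    rw [Filter.EventuallyEq, ae_iff_of_countable]
    intro a ha
    have h1 : p {a} = p.rnDeriv q a * q {a} := by
      conv_lhs => rw [← Measure.withDensity_rnDeriv_eq p q hac,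
        withDensity_apply _ (measurableSet_singleton a), lintegral_singleton]
    have h2 : p.real {a} = (p.rnDeriv q a).toReal * q.real {a} := by
      rw [measureReal_def, h1, ENNReal.toReal_mul]; rfl
    have h3 : p.real {a} ≠ 0 := by
      rw [measureReal_def]; exact ENNReal.toReal_ne_zero.2 ⟨ha, measure_ne_top _ _⟩
    rw [llr, ← Real.log_div h3 (hq a).ne', h2, mul_div_cancel_right₀ _ (hq a).ne']
  rw [InformationTheory.klDiv_of_ac_of_integrable hac Integrable.of_finite, integral_congr_ae hllr]
  simp

end KullbackLeibler

/-! ### Log-likelihood ratios: second moment against divergence -/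

section LogRatio

variable {S A : Type*} [MeasurableSpace S] [MeasurableSpace A]

theorem Policy.prob_nonneg (π : Policy S A) (s : S) (a : A) : 0 ≤ π.prob s a := measureReal_nonneg

theorem Policy.prob_le_one (π : Policy S A) (s : S) (a : A) : π.prob s a ≤ 1 :=
  measureReal_le_one

theorem Policy.measurable_prob [Countable A] [MeasurableSingletonClass A] (π : Policy S A) :
    Measurable fun x : S × A => π.prob x.1 x.2 :=
  measurable_from_prod_countable_left fun a =>
    (π.kernel.measurable_coe (measurableSet_singleton a)).ennreal_toReal

theorem Policy.measurable_log_prob [Countable A] [MeasurableSingletonClass A] (π : Policy S A) :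
    Measurable fun x : S × A => Real.log (π.prob x.1 x.2) := π.measurable_prob.log

/-- The log-likelihood ratio `log π₁(a | s) - log π₂(a | s)`. -/
noncomputable def logRatio (π₁ π₂ : Policy S A) (x : S × A) : ℝ :=
  Real.log (π₁.prob x.1 x.2) - Real.log (π₂.prob x.1 x.2)

theorem measurable_logRatio [Countable A] [MeasurableSingletonClass A] (π₁ π₂ : Policy S A) :
    Measurable (logRatio π₁ π₂) := π₁.measurable_log_prob.sub π₂.measurable_log_prob

theorem logRatio_le {α : ℝ} (hα : 0 < α) {π₁ π₂ : Policy S A}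
    (hπ : ∀ s a, α ≤ π₂.prob s a) (x : S × A) : logRatio π₁ π₂ x ≤ Real.log (1 / α) := by
  have h1 := Real.log_nonpos (π₁.prob_nonneg x.1 x.2) (π₁.prob_le_one x.1 x.2)
  have h2 := Real.log_le_log hα (hπ x.1 x.2)
  rw [one_div, Real.log_inv, logRatio]
  linarith

instance (d : Measure S) [IsProbabilityMeasure d] (π : Policy S A) :
    IsProbabilityMeasure (stateActionLaw d π) := by
  unfold stateActionLaw; infer_instance

theorem expKL_nonneg (d : Measure S) (π₁ π₂ : Policy S A) : 0 ≤ expKL d π₁ π₂ :=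
  ENNReal.toReal_nonneg

theorem stateActionLaw_eq_comp (d : Measure S) [IsProbabilityMeasure d] (π : Policy S A) :
    stateActionLaw d π = (Kernel.id ×ₖ π.kernel) ∘ₘ d :=
  Measure.compProd_eq_comp_prod d π.kernel

variable [Finite A] [MeasurableSingletonClass A]

theorem integral_sq_logRatio_kernel_le {α : ℝ} (hα : 0 < α) (hα1 : α ≤ 1) (π₁ π₂ : Policy S A)
    (hπ : ∀ s a, α ≤ π₂.prob s a) (s : S) :
    ∫ a, logRatio π₁ π₂ (s, a) ^ 2 ∂π₁.kernel s
      ≤ 2 * (Real.log (1 / α) + 2) * ∫ a, logRatio π₁ π₂ (s, a) ∂π₁.kernel s := by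
  have := Fintype.ofFinite A
  have hone : ∀ π : Policy S A, ∑ a, π.prob s a = 1 := fun π => by
    have h := integral_fintype (μ := π.kernel s) (f := fun _ => (1 : ℝ)) Integrable.of_finite
    simp only [integral_const, probReal_univ, smul_eq_mul, mul_one] at h
    exact h.symm
  rw [integral_fintype Integrable.of_finite, integral_fintype Integrable.of_finite]
  calc ∑ a, (π₁.kernel s).real {a} • logRatio π₁ π₂ (s, a) ^ 2
      ≤ ∑ a, 2 * (Real.log (1 / α) + 2) *
        (π₁.prob s a * logRatio π₁ π₂ (s, a) + π₂.prob s a - π₁.prob s a) :=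
        Finset.sum_le_sum fun a _ => mul_sq_log_sub_log_le hα hα1 (π₁.prob_nonneg s a)
          (π₁.prob_le_one s a) (hπ s a)
    _ = _ := by
        rw [← Finset.mul_sum, Finset.sum_sub_distrib, Finset.sum_add_distrib, hone, hone]
        simp [Policy.prob]

theorem integral_logRatio_kernel_nonneg {α : ℝ} (hα : 0 < α) (hα1 : α ≤ 1) (π₁ π₂ : Policy S A)
    (hπ : ∀ s a, α ≤ π₂.prob s a) (s : S) :
    0 ≤ ∫ a, logRatio π₁ π₂ (s, a) ∂π₁.kernel s := by
  have h := integral_sq_logRatio_kernel_le hα hα1 π₁ π₂ hπ s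
  have h0 : 0 ≤ ∫ a, logRatio π₁ π₂ (s, a) ^ 2 ∂π₁.kernel s := integral_nonneg fun _ => sq_nonneg _
  have hL : 0 ≤ Real.log (1 / α) := Real.log_nonneg (one_le_one_div hα hα1)
  exact nonneg_of_mul_nonneg_right (h0.trans h) (by linarith)

/-- Without a floor on `π₁` the ratio can be unbounded below. Its second moment on each fibre is
nevertheless at most `2 (L + 2)` times the fibre divergence, itself at most `L = log (1/α)`. -/
theorem memLp_logRatio {α : ℝ} (hα : 0 < α) (hα1 : α ≤ 1) (d : Measure S) [IsProbabilityMeasure d]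
    (π₁ π₂ : Policy S A) (hπ : ∀ s a, α ≤ π₂.prob s a) :
    MemLp (logRatio π₁ π₂) 2 (stateActionLaw d π₁) := by
  have hm := measurable_logRatio π₁ π₂
  have hL : 0 ≤ Real.log (1 / α) := Real.log_nonneg (one_le_one_div hα hα1)
  have hm2 : Measurable fun x => logRatio π₁ π₂ x ^ 2 := hm.pow_const 2
  rw [memLp_two_iff_integrable_sq hm.aestronglyMeasurable, stateActionLaw,
    Measure.integrable_compProd_iff hm2.aestronglyMeasurable]
  refine ⟨Filter.Eventually.of_forall fun s => Integrable.of_finite, ?_⟩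
  refine Integrable.of_bound (C := 2 * (Real.log (1 / α) + 2) * Real.log (1 / α))
    (StronglyMeasurable.integral_kernel_prod_right (κ := π₁.kernel)
      (f := fun s a => ‖logRatio π₁ π₂ (s, a) ^ 2‖)
      hm2.norm.stronglyMeasurable).aestronglyMeasurable
    (Filter.Eventually.of_forall fun s => ?_)
  rw [Real.norm_of_nonneg (integral_nonneg fun _ => norm_nonneg _)]
  have hn : ∀ a, ‖logRatio π₁ π₂ (s, a) ^ 2‖ = logRatio π₁ π₂ (s, a) ^ 2 := fun a =>
    Real.norm_of_nonneg (sq_nonneg _)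
  simp_rw [hn]
  refine (integral_sq_logRatio_kernel_le hα hα1 π₁ π₂ hπ s).trans ?_
  gcongr
  calc ∫ a, logRatio π₁ π₂ (s, a) ∂π₁.kernel s ≤ ∫ a, Real.log (1 / α) ∂π₁.kernel s :=
        integral_mono Integrable.of_finite Integrable.of_finite fun a => logRatio_le hα hπ (s, a)
    _ = _ := by simp

theorem integrable_logRatio {α : ℝ} (hα : 0 < α) (hα1 : α ≤ 1) (d : Measure S)
    [IsProbabilityMeasure d] (π₁ π₂ : Policy S A) (hπ : ∀ s a, α ≤ π₂.prob s a) :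
    Integrable (logRatio π₁ π₂) (stateActionLaw d π₁) :=
  (memLp_logRatio hα hα1 d π₁ π₂ hπ).integrable one_le_two

theorem expKL_eq_integral_logRatio {α : ℝ} (hα : 0 < α) (hα1 : α ≤ 1) (d : Measure S)
    [IsProbabilityMeasure d] (π₁ π₂ : Policy S A) (hπ : ∀ s a, α ≤ π₂.prob s a) :
    expKL d π₁ π₂ = ∫ x, logRatio π₁ π₂ x ∂stateActionLaw d π₁ := by
  have hi := integrable_logRatio hα hα1 d π₁ π₂ hπ
  rw [stateActionLaw] at hi ⊢
  rw [Measure.integral_compProd hi, expKL, integral_eq_lintegral_of_nonneg_ae]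
  · congr 1
    refine lintegral_congr fun s => ?_
    rw [klDiv_eq_ofReal_integral_log_sub_log _ _ fun a => hα.trans_le (hπ s a)]
    rfl
  · exact Filter.Eventually.of_forall fun s =>
      integral_logRatio_kernel_nonneg hα hα1 π₁ π₂ hπ s
  · exact (StronglyMeasurable.integral_kernel_prod_right (κ := π₁.kernel)
      (f := fun s a => logRatio π₁ π₂ (s, a))
      (measurable_logRatio π₁ π₂).stronglyMeasurable).aestronglyMeasurable

theorem integral_sq_logRatio_le {α : ℝ} (hα : 0 < α) (hα1 : α ≤ 1) (d : Measure S)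
    [IsProbabilityMeasure d] (π₁ π₂ : Policy S A) (hπ : ∀ s a, α ≤ π₂.prob s a) :
    ∫ x, logRatio π₁ π₂ x ^ 2 ∂stateActionLaw d π₁
      ≤ 2 * (Real.log (1 / α) + 2) * expKL d π₁ π₂ := by
  rw [expKL_eq_integral_logRatio hα hα1 d π₁ π₂ hπ]
  have hi := integrable_logRatio hα hα1 d π₁ π₂ hπ
  have hi2 := (memLp_logRatio hα hα1 d π₁ π₂ hπ).integrable_sq
  rw [stateActionLaw] at hi hi2 ⊢
  rw [Measure.integral_compProd hi, Measure.integral_compProd hi2, ← integral_const_mul]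
  exact integral_mono hi2.integral_compProd (hi.integral_compProd.const_mul _) fun s =>
    integral_sq_logRatio_kernel_le hα hα1 π₁ π₂ hπ s

end LogRatio

/-! ### Invariant law of the state-action chain -/

section Invariance

variable {S A : Type*} [MeasurableSpace S] [MeasurableSpace A]

theorem comp_stateActionLaw_of_invariant {P : Kernel (S × A) S} [IsMarkovKernel P]
    {π : Policy S A} {d : Measure S} [IsProbabilityMeasure d]
    (h : Kernel.Invariant (stateKernel P π) d) : P ∘ₘ stateActionLaw d π = d := by
  rw [stateActionLaw_eq_comp, Measure.comp_assoc]
  exact h.def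

theorem invariant_jointKernel {P : Kernel (S × A) S} [IsMarkovKernel P]
    {π : Policy S A} {d : Measure S} [IsProbabilityMeasure d]
    (h : Kernel.Invariant (stateKernel P π) d) :
    Kernel.Invariant (jointKernel P π) (stateActionLaw d π) := by
  rw [Kernel.Invariant, jointKernel, ← Measure.comp_assoc, comp_stateActionLaw_of_invariant h,
    stateActionLaw_eq_comp]

instance (P : Kernel (S × A) S) [IsMarkovKernel P] (π : Policy S A) :
    IsMarkovKernel (jointKernel P π) := by
  unfold jointKernel; infer_instance

end Invariance

/-! ### Least-squares rewards and orthogonality -/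

section LeastSquares

theorem sq_integral_le_integral_sq {X : Type*} [MeasurableSpace X] {μ : Measure X}
    [IsProbabilityMeasure μ] {f : X → ℝ} (hf : MemLp f 2 μ) :
    (∫ x, f x ∂μ) ^ 2 ≤ ∫ x, f x ^ 2 ∂μ := by
  have hi := hf.integrable one_le_two
  set c := ∫ x, f x ∂μ with hc
  have h0 : 0 ≤ ∫ x, (f x - c) ^ 2 ∂μ := integral_nonneg fun _ => sq_nonneg _
  have hexp : ∀ x, (f x - c) ^ 2 = f x ^ 2 - 2 * c * f x + c ^ 2 := fun x => by ring
  have i1 : Integrable (fun x => 2 * c * f x) μ := hi.const_mul _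
  have i2 : Integrable (fun x => f x ^ 2 - 2 * c * f x) μ := hf.integrable_sq.sub i1
  simp_rw [hexp] at h0
  rw [integral_add i2 (integrable_const _), integral_sub hf.integrable_sq i1,
    integral_const_mul, ← hc] at h0
  simp at h0
  nlinarith

/-- The first-order condition at a minimizer of a quadratic functional on a line. -/
theorem integral_mul_eq_zero_of_forall_le {X : Type*} [MeasurableSpace X] {μ : Measure X}
    {R b : X → ℝ} (hR : MemLp R 2 μ) (hb : MemLp b 2 μ)
    (h : ∀ t : ℝ, ∫ x, R x ^ 2 ∂μ ≤ ∫ x, (R x + t * b x) ^ 2 ∂μ) : ∫ x, R x * b x ∂μ = 0 := by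
  have hRb : Integrable (fun x => R x * b x) μ := hR.integrable_mul hb
  have hexp : ∀ t x, (R x + t * b x) ^ 2 = R x ^ 2 + 2 * t * (R x * b x) + t ^ 2 * b x ^ 2 :=
    fun t x => by ring
  set I := ∫ x, R x * b x ∂μ
  set B := ∫ x, b x ^ 2 ∂μ
  have hB : 0 ≤ B := integral_nonneg fun _ => sq_nonneg _
  have hq : ∀ t : ℝ, 0 ≤ 2 * t * I + t ^ 2 * B := fun t => by
    have h1 := h t
    simp_rw [hexp] at h1
    have i1 : Integrable (fun x => R x ^ 2 + 2 * t * (R x * b x)) μ :=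
      hR.integrable_sq.add (hRb.const_mul _)
    rw [integral_add i1 (hb.integrable_sq.const_mul _),
      integral_add hR.integrable_sq (hRb.const_mul _), integral_const_mul,
      integral_const_mul] at h1
    linarith
  -- Nearly the minimizer `-I / B`; the `+ 1` covers `B = 0`.
  have h2 := hq (-I / (B + 1))
  have e : 2 * (-I / (B + 1)) * I + (-I / (B + 1)) ^ 2 * B
      = -(I ^ 2 * (B + 2)) / (B + 1) ^ 2 := by
    field_simp
    ring
  rw [e, le_div_iff₀ (by positivity), zero_mul] at h2
  have h3 : I ^ 2 * (B + 2) = 0 := le_antisymm (by linarith) (by positivity)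
  rcases mul_eq_zero.1 h3 with h4 | h4
  · exact pow_eq_zero_iff two_ne_zero |>.1 h4
  · linarith

variable {S A : Type*} [MeasurableSpace S] [MeasurableSpace A]

theorem lsObjective_eq_ofReal {P : Kernel (S × A) S} {ρ : Measure (S × A)} {γ lam : ℝ} {π' : Policy S A} {f : S → ℝ}
    (h : MemLp (shapedReward P γ lam π' f) 2 ρ) :
    lsObjective P γ lam ρ π' f = ENNReal.ofReal (∫ x, shapedReward P γ lam π' f x ^ 2 ∂ρ) := by
  rw [lsObjective, ofReal_integral_eq_lintegral_ofReal h.integrable_sq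
    (Filter.Eventually.of_forall fun _ => sq_nonneg _)]

/-- Since `d` is the law of the next state under `ν`, disintegration transfers square-integrability
to almost every fibre. The linearity of `bellmanOp` relies on this, as Bochner integrals are
additive only for integrable functions. -/
theorem ae_memLp_kernel {P : Kernel (S × A) S} [IsMarkovKernel P] {ν : Measure (S × A)}
    {d : Measure S} (hP : P ∘ₘ ν = d) {f : S → ℝ} (hf : MemLp f 2 d) :
    ∀ᵐ x ∂ν, MemLp f 2 (P x) := by
  obtain ⟨f', hf'm, hff'⟩ := hf.1
  have hf' : MemLp f' 2 d := hf.ae_eq hff'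
  have hfin : ∫⁻ x, ∫⁻ y, ‖f' y‖ₑ ^ (2 : ℝ) ∂P x ∂ν < ∞ := by
    have h := lintegral_rpow_enorm_lt_top_of_eLpNorm_lt_top two_ne_zero ENNReal.ofNat_ne_top hf'.2
    rw [← hP, Measure.lintegral_bind P.aemeasurable
      (hf'm.enorm.pow_const _).aemeasurable] at h
    simpa using h
  have h1 : ∀ᵐ x ∂ν, ∫⁻ y, ‖f' y‖ₑ ^ (2 : ℝ) ∂P x < ∞ :=
    ae_lt_top (hf'm.enorm.pow_const _).lintegral_kernel hfin.ne
  have h2 : ∀ᵐ x ∂ν, f =ᵐ[P x] f' := by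
    rw [← hP] at hff'
    exact Measure.ae_ae_of_ae_comp hff'
  filter_upwards [h1, h2] with x hx1 hx2
  refine MemLp.ae_eq hx2.symm ⟨hf'm.aestronglyMeasurable, ?_⟩
  rw [eLpNorm_lt_top_iff_lintegral_rpow_enorm_lt_top two_ne_zero ENNReal.ofNat_ne_top]
  simpa using hx1

theorem memLp_integral_kernel {P : Kernel (S × A) S} [IsMarkovKernel P] {ν : Measure (S × A)}
    [IsProbabilityMeasure ν] {d : Measure S} (hP : P ∘ₘ ν = d) {f : S → ℝ} (hf : MemLp f 2 d) :
    MemLp (fun x => ∫ y, f y ∂P x) 2 ν := by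
  have hcomp : (P ∘ₖ Kernel.const Unit ν) () = d := by rw [Kernel.comp_const, hP, Kernel.const_apply]
  have hmeas : AEStronglyMeasurable (fun x => ∫ y, f y ∂P x) ν := by
    have hi : Integrable f ((P ∘ₖ Kernel.const Unit ν) ()) := by
      rw [hcomp]
      have : IsProbabilityMeasure d := by rw [← hcomp]; infer_instance
      exact hf.integrable one_le_two
    have := hi.integral_comp.aestronglyMeasurable
    rwa [Kernel.const_apply] at this
  rw [memLp_two_iff_integrable_sq hmeas]
  have hi : Integrable (fun y => f y ^ 2) ((P ∘ₖ Kernel.const Unit ν) ()) := by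
    rw [hcomp]; exact hf.integrable_sq
  have hi2 := hi.integral_comp
  rw [Kernel.const_apply] at hi2
  refine hi2.mono' (hmeas.pow 2) ?_
  filter_upwards [ae_memLp_kernel hP hf] with x hx
  rw [Real.norm_of_nonneg (sq_nonneg _)]
  exact sq_integral_le_integral_sq hx

variable {P : Kernel (S × A) S} [IsMarkovKernel P] {π : Policy S A} {d : Measure S}
  [IsProbabilityMeasure d]

theorem memLp_bellmanOp (hinv : Kernel.Invariant (stateKernel P π) d) (γ : ℝ) {f : S → ℝ}
    (hf : MemLp f 2 d) : MemLp (bellmanOp P γ f) 2 (stateActionLaw d π) := by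
  have h1 : MemLp (fun x : S × A => f x.1) 2 (stateActionLaw d π) := by
    have hmp : MeasurePreserving (Prod.fst : S × A → S) (stateActionLaw d π) d :=
      ⟨measurable_fst, Measure.fst_compProd d π.kernel⟩
    exact hf.comp_measurePreserving hmp
  exact h1.sub ((memLp_integral_kernel (comp_stateActionLaw_of_invariant hinv) hf).const_mul γ)

theorem bellmanOp_add_smul_ae (hinv : Kernel.Invariant (stateKernel P π) d) (γ : ℝ)
    {f g : S → ℝ} (hf : MemLp f 2 d) (hg : MemLp g 2 d) (t : ℝ) :
    bellmanOp P γ (fun s => f s + t * g s)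
      =ᵐ[stateActionLaw d π] fun x => bellmanOp P γ f x + t * bellmanOp P γ g x := by
  have hP := comp_stateActionLaw_of_invariant hinv
  filter_upwards [ae_memLp_kernel hP hf, ae_memLp_kernel hP hg] with x hx1 hx2
  rw [bellmanOp, bellmanOp, bellmanOp,
    integral_add (hx1.integrable one_le_two) ((hx2.integrable one_le_two).const_mul t),
    integral_const_mul]
  ring

/-- The least-squares reward is orthogonal to the range of the Bellman operator. -/
theorem IsLSPotential.integral_mul_bellmanOp_eq_zero
    (hinv : Kernel.Invariant (stateKernel P π) d) {ρ : Measure (S × A)} {c : ℝ≥0∞} (hc : c ≠ ∞)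
    (hρ : ρ ≤ c • stateActionLaw d π) {γ lam : ℝ} {π' : Policy S A}
    (hπ' : MemLp (logPolicy lam π') 2 ρ) {f : S → ℝ} (hf : IsLSPotential P γ lam d ρ π' f)
    {g : S → ℝ} (hg : MemLp g 2 d) :
    ∫ x, shapedReward P γ lam π' f x * bellmanOp P γ g x ∂ρ = 0 := by
  have hac : ρ ≪ stateActionLaw d π := Measure.absolutelyContinuous_of_le_smul hρ
  have hB : ∀ {h : S → ℝ}, MemLp h 2 d → MemLp (bellmanOp P γ h) 2 ρ := fun hh =>
    (memLp_bellmanOp hinv γ hh).of_measure_le_smul hc hρ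
  have hR : ∀ {h : S → ℝ}, MemLp h 2 d → MemLp (shapedReward P γ lam π' h) 2 ρ := fun hh =>
    hπ'.add (hB hh)
  refine integral_mul_eq_zero_of_forall_le (hR hf.1) (hB hg) fun t => ?_
  have hft : MemLp (fun s => f s + t * g s) 2 d := hf.1.add (hg.const_mul t)
  have h := hf.2 _ hft
  rw [lsObjective_eq_ofReal (hR hf.1), lsObjective_eq_ofReal (hR hft),
    ENNReal.ofReal_le_ofReal_iff (integral_nonneg fun _ => sq_nonneg _)] at h
  refine h.trans_eq (integral_congr_ae ?_)
  filter_upwards [hac.ae_le (bellmanOp_add_smul_ae hinv γ hf.1 hg t)] with x hx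
  simp only [shapedReward, hx]
  ring

/-- The least-squares reward depends on the log-policy in a non-expansive way. -/
theorem IsLSPotential.integral_sq_shapedReward_sub_le
    (hinv : Kernel.Invariant (stateKernel P π) d) {ρ : Measure (S × A)} {c : ℝ≥0∞} (hc : c ≠ ∞)
    (hρ : ρ ≤ c • stateActionLaw d π) {γ lam : ℝ} {π₁ π₂ : Policy S A}
    (hπ₁ : MemLp (logPolicy lam π₁) 2 ρ) (hπ₂ : MemLp (logPolicy lam π₂) 2 ρ) {f₁ f₂ : S → ℝ}
    (hf₁ : IsLSPotential P γ lam d ρ π₁ f₁) (hf₂ : IsLSPotential P γ lam d ρ π₂ f₂) :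
    MemLp (fun x => shapedReward P γ lam π₁ f₁ x - shapedReward P γ lam π₂ f₂ x) 2 ρ ∧
    ∫ x, (shapedReward P γ lam π₁ f₁ x - shapedReward P γ lam π₂ f₂ x) ^ 2 ∂ρ
      ≤ ∫ x, (logPolicy lam π₁ x - logPolicy lam π₂ x) ^ 2 ∂ρ := by
  have hac : ρ ≪ stateActionLaw d π := Measure.absolutelyContinuous_of_le_smul hρ
  -- The log-policy difference is `D - bellmanOp P γ h` almost everywhere, with `D` orthogonal to
  -- the second term: Pythagoras applies, and the potentials need not be unique.
  set h : S → ℝ := fun s => f₁ s + (-1) * f₂ s with hh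
  have hhm : MemLp h 2 d := hf₁.1.add (hf₂.1.const_mul (-1))
  have hb : ∀ {g : S → ℝ}, MemLp g 2 d → MemLp (bellmanOp P γ g) 2 ρ := fun hg =>
    (memLp_bellmanOp hinv γ hg).of_measure_le_smul hc hρ
  have hR₁ : MemLp (shapedReward P γ lam π₁ f₁) 2 ρ := hπ₁.add (hb hf₁.1)
  have hR₂ : MemLp (shapedReward P γ lam π₂ f₂) 2 ρ := hπ₂.add (hb hf₂.1)
  have hbh := hb hhm
  have o₁ := hf₁.integral_mul_bellmanOp_eq_zero hinv hc hρ hπ₁ hhm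
  have o₂ := hf₂.integral_mul_bellmanOp_eq_zero hinv hc hρ hπ₂ hhm
  have i₁ : Integrable (fun x => shapedReward P γ lam π₁ f₁ x * bellmanOp P γ h x) ρ :=
    hR₁.integrable_mul hbh
  have i₂ : Integrable (fun x => shapedReward P γ lam π₂ f₂ x * bellmanOp P γ h x) ρ :=
    hR₂.integrable_mul hbh
  have hD : MemLp (fun x => shapedReward P γ lam π₁ f₁ x - shapedReward P γ lam π₂ f₂ x) 2 ρ :=
    hR₁.sub hR₂
  refine ⟨hD, ?_⟩
  set D := fun x => shapedReward P γ lam π₁ f₁ x - shapedReward P γ lam π₂ f₂ x with hDdef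
  have hDb : Integrable (fun x => D x * bellmanOp P γ h x) ρ := hD.integrable_mul hbh
  have hDb0 : ∫ x, D x * bellmanOp P γ h x ∂ρ = 0 := by
    simp only [hDdef, sub_mul]
    rw [integral_sub i₁ i₂, o₁, o₂, sub_zero]
  have hexp : ∫ x, (logPolicy lam π₁ x - logPolicy lam π₂ x) ^ 2 ∂ρ
      = ∫ x, (D x ^ 2 - 2 * (D x * bellmanOp P γ h x) + bellmanOp P γ h x ^ 2) ∂ρ := by
    refine integral_congr_ae ?_
    filter_upwards [hac.ae_le (bellmanOp_add_smul_ae hinv γ hf₁.1 hf₂.1 (-1))] with x hx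
    simp only [hDdef, shapedReward, hh, hx]
    ring
  have i3 : Integrable (fun x => D x ^ 2 - 2 * (D x * bellmanOp P γ h x)) ρ :=
    hD.integrable_sq.sub (hDb.const_mul 2)
  rw [hexp, integral_add i3 hbh.integrable_sq,
    integral_sub hD.integrable_sq (hDb.const_mul 2), integral_const_mul, hDb0]
  have : 0 ≤ ∫ x, bellmanOp P γ h x ^ 2 ∂ρ := integral_nonneg fun _ => sq_nonneg _
  linarith

theorem eLpNorm_two_sq_eq_ofReal_integral {X : Type*} [MeasurableSpace X] {μ : Measure X}
    {f : X → ℝ} (hf : MemLp f 2 μ) :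
    eLpNorm f 2 μ ^ 2 = ENNReal.ofReal (∫ x, f x ^ 2 ∂μ) := by
  have h := hf.eLpNorm_eq_integral_rpow_norm two_ne_zero ENNReal.ofNat_ne_top
  rw [h, ← ENNReal.ofReal_pow (by positivity), ← Real.rpow_natCast, ← Real.rpow_mul
    (integral_nonneg fun _ => by positivity)]
  simp

variable [Finite A] [MeasurableSingletonClass A]

theorem memLp_log_prob_self {α : ℝ} (hα : 0 < α) (hα1 : α ≤ 1) {π₂ : Policy S A}
    (hπ : ∀ s a, α ≤ π₂.prob s a) :
    MemLp (fun x : S × A => Real.log (π.prob x.1 x.2)) 2 (stateActionLaw d π) ∧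
    MemLp (fun x : S × A => Real.log (π₂.prob x.1 x.2)) 2 (stateActionLaw d π) := by
  have h1 : MemLp (fun x : S × A => Real.log (π₂.prob x.1 x.2)) 2 (stateActionLaw d π) := by
    refine MemLp.of_bound π₂.measurable_log_prob.aestronglyMeasurable (Real.log (1 / α))
      (Filter.Eventually.of_forall fun x => ?_)
    have h1 := Real.log_nonpos (π₂.prob_nonneg x.1 x.2) (π₂.prob_le_one x.1 x.2)
    have h2 := Real.log_le_log hα (hπ x.1 x.2)
    rw [Real.norm_eq_abs, abs_of_nonpos h1, one_div, Real.log_inv]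
    linarith
  refine ⟨?_, h1⟩
  have h := (memLp_logRatio hα hα1 d π π₂ hπ).add h1
  refine h.congr_norm π.measurable_log_prob.aestronglyMeasurable
    (Filter.Eventually.of_forall fun x => ?_)
  simp [logRatio]

/-- The reward error of a policy is controlled by its expected Kullback-Leibler divergence. -/
theorem eLpNorm_shapedReward_sub_sq_le {α : ℝ} (hα : 0 < α) (hα1 : α ≤ 1)
    (hinv : Kernel.Invariant (stateKernel P π) d) {γ lam : ℝ}
    {ρ : Measure (S × A)} {w : S × A → ℝ} (hw : Measurable w) (hw0 : 0 < ⨅ x, w x)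
    (hwb : BddAbove (Set.range w))
    (hρ : ρ = (stateActionLaw d π).withDensity (fun x => ENNReal.ofReal (w x)))
    {π₂ : Policy S A} (hπ : ∀ s a, α ≤ π₂.prob s a) {f₂ f : S → ℝ}
    (hf₂ : IsLSPotential P γ lam d ρ π₂ f₂) (hf : IsLSPotential P γ lam d ρ π f) :
    eLpNorm (fun x => shapedReward P γ lam π₂ f₂ x - shapedReward P γ lam π f x) 2
        (stateActionLaw d π) ^ 2
      ≤ ENNReal.ofReal (lam ^ 2 * ((⨆ x, w x) / (⨅ x, w x)) *
          (2 * (Real.log (1 / α) + 2) * expKL d π π₂)) := by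
  -- A real infimum is `0` by convention for a family that is empty or unbounded below, so `hw0`
  -- excludes both cases.
  have hbelow : BddBelow (Set.range w) := by
    by_contra hb
    exact hw0.ne' (Real.iInf_of_not_bddBelow hb)
  have hmin : ∀ x, (⨅ x, w x) ≤ w x := ciInf_le hbelow
  have hmax : ∀ x, w x ≤ ⨆ x, w x := le_ciSup hwb
  set a := ⨅ x, w x
  set b := ⨆ x, w x
  have hwnn : ∀ x, 0 ≤ w x := fun x => hw0.le.trans (hmin x)
  set ν := stateActionLaw d π with hν
  have hle : ρ ≤ ENNReal.ofReal b • ν := by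
    rw [hρ, ← withDensity_const]
    exact withDensity_mono (Filter.Eventually.of_forall fun x => ENNReal.ofReal_le_ofReal (hmax x))
  have hint : ∀ φ : S × A → ℝ, ∫ x, φ x ∂ρ = ∫ x, w x * φ x ∂ν := fun φ => by
    rw [hρ, integral_withDensity_eq_integral_toReal_smul hw.ennreal_ofReal
      (Filter.Eventually.of_forall fun x => ENNReal.ofReal_lt_top)]
    simp_rw [ENNReal.toReal_ofReal (hwnn _), smul_eq_mul]
  obtain ⟨hl, hl₂⟩ := memLp_log_prob_self (d := d) (π := π) hα hα1 hπ
  have hlν : MemLp (logPolicy lam π) 2 ν := hl.const_mul lam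
  have hl₂ν : MemLp (logPolicy lam π₂) 2 ν := hl₂.const_mul lam
  have hlρ : MemLp (logPolicy lam π) 2 ρ := hlν.of_measure_le_smul ENNReal.ofReal_ne_top hle
  have hl₂ρ : MemLp (logPolicy lam π₂) 2 ρ := hl₂ν.of_measure_le_smul ENNReal.ofReal_ne_top hle
  have hDν : MemLp (fun x => shapedReward P γ lam π₂ f₂ x - shapedReward P γ lam π f x) 2 ν :=
    (hl₂ν.add (memLp_bellmanOp hinv γ hf₂.1)).sub (hlν.add (memLp_bellmanOp hinv γ hf.1))
  obtain ⟨-, hD⟩ :=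
    hf₂.integral_sq_shapedReward_sub_le hinv ENNReal.ofReal_ne_top hle hl₂ρ hlρ hf
  rw [eLpNorm_two_sq_eq_ofReal_integral hDν]
  apply ENNReal.ofReal_le_ofReal
  rw [hint, hint] at hD
  set D := fun x => shapedReward P γ lam π₂ f₂ x - shapedReward P γ lam π f x
  have hwbd : ∀ᵐ x ∂ν, ‖w x‖ ≤ b := Filter.Eventually.of_forall fun x => by
    rw [Real.norm_of_nonneg (hwnn x)]; exact hmax x
  have hr : MemLp (logRatio π π₂) 2 ν := memLp_logRatio hα hα1 d π π₂ hπ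
  have h1 : a * ∫ x, D x ^ 2 ∂ν ≤ ∫ x, w x * D x ^ 2 ∂ν := by
    rw [← integral_const_mul]
    exact integral_mono (hDν.integrable_sq.const_mul a)
      (hDν.integrable_sq.bdd_mul hw.aestronglyMeasurable hwbd)
      fun x => mul_le_mul_of_nonneg_right (hmin x) (sq_nonneg _)
  have h2 : ∫ x, w x * (logPolicy lam π₂ x - logPolicy lam π x) ^ 2 ∂ν
      ≤ b * (lam ^ 2 * ∫ x, logRatio π π₂ x ^ 2 ∂ν) := by
    rw [← integral_const_mul, ← integral_const_mul]
    have e : ∀ x, (logPolicy lam π₂ x - logPolicy lam π x) ^ 2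
        = lam ^ 2 * logRatio π π₂ x ^ 2 := fun x => by
      simp only [logPolicy, logRatio]; ring
    simp_rw [e]
    have hi := hr.integrable_sq.const_mul (lam ^ 2)
    exact integral_mono (hi.bdd_mul hw.aestronglyMeasurable hwbd) (hi.const_mul b)
      fun x => mul_le_mul_of_nonneg_right (hmax x) (by positivity)
  have h3 := integral_sq_logRatio_le hα hα1 d π π₂ hπ
  have hne : Nonempty (S × A) := by
    by_contra hemp
    rw [not_nonempty_iff] at hemp
    exact hw0.ne' (Real.iInf_of_isEmpty w)
  have hb0 : 0 ≤ b := hne.elim fun x => (hwnn x).trans (hmax x)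
  have h4 : a * ∫ x, D x ^ 2 ∂ν
      ≤ b * (lam ^ 2 * (2 * (Real.log (1 / α) + 2) * expKL d π π₂)) := by
    refine h1.trans (hD.trans (h2.trans ?_))
    gcongr
  calc ∫ x, D x ^ 2 ∂ν
      ≤ b * (lam ^ 2 * (2 * (Real.log (1 / α) + 2) * expKL d π π₂)) / a := by
        rw [le_div_iff₀ hw0, mul_comm]; exact h4
    _ = _ := by ring

end LeastSquares

/-! ### Finite nets inside the policy class -/

section Net

variable {S A : Type*} [MeasurableSpace S] [MeasurableSpace A]

/-- A policy class with a covering number bound has a finite net made of policies of the class. -/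
theorem Policy.HasLogCovering.exists_finset_net {F : Set (Policy S A)} {D Λ : ℝ}
    (h : Policy.HasLogCovering F D Λ) (hF : F.Nonempty) {ε : ℝ} (hε : 0 < ε) (hεΛ : ε ≤ Λ) :
    ∃ G : Finset (Policy S A), (∀ π ∈ G, π ∈ F) ∧
      (G.card : ℝ≥0∞) ≤ ENNReal.ofReal (Real.exp (D * Real.log (Λ / ε))) ∧
      ∀ π ∈ F, ∃ π' ∈ G, ∀ s a, |π.prob s a - π'.prob s a| ≤ 2 * ε := by
  classical
  have : Nonempty (Policy S A) := ⟨hF.some⟩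
  lift ε to ℝ≥0 using hε.le
  have h1 := h ε (by exact_mod_cast hε) hεΛ
  rw [← Real.log_exp (D * Real.log (Λ / ε)), ← ENNReal.log_ofReal_of_pos (Real.exp_pos _),
    ENNReal.log_le_log_iff] at h1
  -- Centres of an external cover need not be policies with floor `α`; recentring inside `F` doubles
  -- the radius.
  have h2 : ((Metric.coveringNumber (2 * ε) (Policy.toUniformFun '' F) : ℕ∞) : ℝ≥0∞)
      ≤ ENNReal.ofReal (Real.exp (D * Real.log (Λ / ε))) :=
    le_trans (ENat.toENNReal_mono (Metric.coveringNumber_two_mul_le_externalCoveringNumber ε _)) h1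
  have hne : Metric.coveringNumber (2 * ε) (Policy.toUniformFun '' F) ≠ ⊤ := by
    intro htop
    rw [htop] at h2
    exact absurd h2 (by simp)
  obtain ⟨C, hCF, hCfin, hC, hcard⟩ := Metric.exists_set_encard_eq_coveringNumber hne
  choose! p hp using fun c (hc : c ∈ C) => hCF hc
  refine ⟨hCfin.toFinset.image p, ?_, ?_, ?_⟩
  · intro π hπ
    obtain ⟨c, hc, rfl⟩ := Finset.mem_image.1 hπ
    exact (hp c (hCfin.mem_toFinset.1 hc)).1
  · refine le_trans ?_ h2
    rw [← hcard, hCfin.encard_eq_coe_toFinset_card]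
    simp only [ENat.toENNReal_coe, Nat.cast_le]
    exact Finset.card_image_le
  · intro π hπ
    obtain ⟨c, hc, hcd⟩ := hC (Set.mem_image_of_mem Policy.toUniformFun hπ)
    refine ⟨p c, Finset.mem_image_of_mem _ (hCfin.mem_toFinset.2 hc), fun s a => ?_⟩
    have hd : edist (Policy.toUniformFun π) c ≤ (2 * ε : ℝ≥0) := hcd
    rw [UniformFun.edist_le] at hd
    have hd := hd (s, a)
    rw [← (hp c hc).2, edist_dist, Real.dist_eq] at hd
    have := (ENNReal.ofReal_le_iff_le_toReal ENNReal.coe_ne_top).1 hd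
    simpa [Policy.toUniformFun] using this

theorem abs_log_sub_log_le {α x y : ℝ} (hα : 0 < α) (hx : α ≤ x) (hy : α ≤ y) :
    |Real.log x - Real.log y| ≤ |x - y| / α := by
  have key : ∀ {x y : ℝ}, α ≤ x → α ≤ y → Real.log x - Real.log y ≤ |x - y| / α := by
    intro x y hx hy
    have hx0 := hα.trans_le hx
    have hy0 := hα.trans_le hy
    rw [← Real.log_div hx0.ne' hy0.ne']
    calc Real.log (x / y) ≤ x / y - 1 := Real.log_le_sub_one_of_pos (by positivity)
      _ = (x - y) / y := by field_simp
      _ ≤ |x - y| / y := by gcongr; exact le_abs_self _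
      _ ≤ |x - y| / α := by gcongr
  rw [abs_le]
  constructor
  · have := key hy hx
    rw [abs_sub_comm] at this
    linarith
  · exact key hx hy

end Net

/-! ### Deviation of the empirical log-likelihood ratio -/

section Deviation

variable {S A : Type*} [MeasurableSpace S] [MeasurableSpace A]

theorem abs_logRatio_le {α : ℝ} (hα : 0 < α) {π₁ π₂ : Policy S A}
    (hπ₁ : ∀ s a, α ≤ π₁.prob s a) (hπ₂ : ∀ s a, α ≤ π₂.prob s a) (x : S × A) :
    |logRatio π₁ π₂ x| ≤ Real.log (1 / α) := by
  rw [abs_le]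
  have h := logRatio_le hα hπ₁ (π₁ := π₂) x
  have e : logRatio π₂ π₁ x = -logRatio π₁ π₂ x := by simp [logRatio]
  exact ⟨by linarith, logRatio_le hα hπ₂ x⟩

variable [Finite A] [MeasurableSingletonClass A]

theorem integral_logRatio_eq_sub {α : ℝ} (hα : 0 < α) (hα1 : α ≤ 1) (d : Measure S)
    [IsProbabilityMeasure d] (π π₁ π₂ : Policy S A) (hπ₁ : ∀ s a, α ≤ π₁.prob s a)
    (hπ₂ : ∀ s a, α ≤ π₂.prob s a) :
    ∫ x, logRatio π₁ π₂ x ∂stateActionLaw d π = expKL d π π₂ - expKL d π π₁ := by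
  rw [expKL_eq_integral_logRatio hα hα1 d π π₂ hπ₂, expKL_eq_integral_logRatio hα hα1 d π π₁ hπ₁,
    ← integral_sub (integrable_logRatio hα hα1 d π π₂ hπ₂)
      (integrable_logRatio hα hα1 d π π₁ hπ₁)]
  simp [logRatio]

theorem integral_sq_logRatio_le_add {α : ℝ} (hα : 0 < α) (hα1 : α ≤ 1) (d : Measure S)
    [IsProbabilityMeasure d] (π π₁ π₂ : Policy S A) (hπ₁ : ∀ s a, α ≤ π₁.prob s a)
    (hπ₂ : ∀ s a, α ≤ π₂.prob s a) :
    ∫ x, logRatio π₁ π₂ x ^ 2 ∂stateActionLaw d π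
      ≤ 4 * (Real.log (1 / α) + 2) * (expKL d π π₂ + expKL d π π₁) := by
  have i1 := (memLp_logRatio hα hα1 d π π₁ hπ₁).integrable_sq.const_mul 2
  have i2 := (memLp_logRatio hα hα1 d π π₂ hπ₂).integrable_sq.const_mul 2
  have h1 := integral_sq_logRatio_le hα hα1 d π π₁ hπ₁
  have h2 := integral_sq_logRatio_le hα hα1 d π π₂ hπ₂
  calc ∫ x, logRatio π₁ π₂ x ^ 2 ∂stateActionLaw d π
      ≤ ∫ x, (2 * logRatio π π₂ x ^ 2 + 2 * logRatio π π₁ x ^ 2) ∂stateActionLaw d π := by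
        refine integral_mono_of_nonneg (Filter.Eventually.of_forall fun x => sq_nonneg _)
          (i2.add i1) (Filter.Eventually.of_forall fun x => ?_)
        have e : logRatio π₁ π₂ x = logRatio π π₂ x - logRatio π π₁ x := by simp [logRatio]
        show logRatio π₁ π₂ x ^ 2 ≤ 2 * logRatio π π₂ x ^ 2 + 2 * logRatio π π₁ x ^ 2
        rw [e]
        nlinarith [sq_nonneg (logRatio π π₂ x + logRatio π π₁ x)]
    _ ≤ _ := by
        rw [integral_add i2 i1, integral_const_mul, integral_const_mul]
        linarith

/-- Deviation of the empirical log-likelihood ratio of two policies from its mean, with variance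
controlled by their Kullback-Leibler divergences to the expert. -/
theorem measure_logRatio_deviation_le {P : Kernel (S × A) S} [IsMarkovKernel P]
    {πstar : Policy S A} {d : Measure S} [IsProbabilityMeasure d]
    (hinv : Kernel.Invariant (stateKernel P πstar) d) {τ : ℕ}
    (herg : UniformlyGeomErgodic (jointKernel P πstar) (stateActionLaw d πstar) τ)
    {Ω : Type*} [MeasurableSpace Ω] {μ : Measure Ω} [IsProbabilityMeasure μ] {N : ℕ}
    {Z : ℕ → Ω → S × A} (hZ : IsMarkovChain μ (jointKernel P πstar) N Z)
    {α : ℝ} (hα : 0 < α) (hα1 : α ≤ 1) {π₀ π : Policy S A} (hπ₀ : ∀ s a, α ≤ π₀.prob s a)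
    (hπ : ∀ s a, α ≤ π.prob s a) {θ : ℝ} (hθ : 0 < θ) (hθ1 : θ ≤ 1 / 4) (x : ℝ) :
    μ {ω | 20 * θ * (expKL d πstar π + expKL d πstar π₀) * N
          + 3 * τ * (Real.log (1 / α) + 2) * x / θ
        ≤ ∑ t ∈ Finset.range N,
          (expKL d πstar π - expKL d πstar π₀ - logRatio π₀ π (Z t ω))}
      ≤ ENNReal.ofReal (4 * Real.exp (-x)) := by
  set L := Real.log (1 / α) with hL
  have hL0 : 0 ≤ L := Real.log_nonneg (one_le_one_div hα hα1)
  set ν := stateActionLaw d πstar with hν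
  set c := expKL d πstar π - expKL d πstar π₀ with hc
  have hmean : ∫ x, logRatio π₀ π x ∂ν = c := integral_logRatio_eq_sub hα hα1 d πstar π₀ π hπ₀ hπ
  have hb := abs_logRatio_le hα hπ₀ hπ
  have hm := measurable_logRatio π₀ π
  have hi : Integrable (logRatio π₀ π) ν := hm.integrable_of_abs_le hb
  have hi2 : Integrable (fun x => logRatio π₀ π x ^ 2) ν :=
    (hm.pow_const 2).integrable_of_abs_le (c := L ^ 2) fun x => by
      rw [abs_pow]; exact pow_le_pow_left₀ (abs_nonneg _) (hb x) 2
  have hcL : |c| ≤ L := by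
    rw [← hmean]
    have := norm_integral_le_of_norm_le_const (μ := ν) (f := logRatio π₀ π)
      (Filter.Eventually.of_forall hb)
    rwa [probReal_univ, mul_one] at this
  have hTV : ∀ x B, MeasurableSet B →
      |((jointKernel P πstar ^ (3 * τ)) x).real B - ν.real B| ≤ 1 / 64 := fun x B hB => by
    have h := herg.2 (3 * τ) x B hB
    rw [Nat.mul_div_cancel _ (by have := herg.1; omega)] at h
    norm_num at h ⊢
    exact h
  -- Three mixing times give `(1/4)³ = 1/64`. The scale `s = θ / (L + 2)` cancels the factor `L + 2`
  -- of the variance proxy, so `5 s V` is `20 θ` times the sum of divergences, and `s b = 2 θ ≤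
  -- 1/2`.
  have h := hZ.measure_sum_ge_le (m := 3 * τ) (by have := herg.1; omega)
    (invariant_jointKernel hinv) hTV (g := fun x => c - logRatio π₀ π x)
    (measurable_const.sub hm) (b := 2 * (L + 2))
    (fun x => by
      have h1 := abs_le.1 (hb x)
      have h2 := abs_le.1 hcL
      rw [abs_le]; constructor <;> linarith)
    (by rw [integral_sub (integrable_const _) hi, hmean]; simp)
    (V := 4 * (L + 2) * (expKL d πstar π + expKL d πstar π₀))
    (by
      refine le_trans ?_ (integral_sq_logRatio_le_add hα hα1 d πstar π₀ π hπ₀ hπ)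
      have e : ∀ x, (c - logRatio π₀ π x) ^ 2
          = logRatio π₀ π x ^ 2 - 2 * c * logRatio π₀ π x + c ^ 2 := fun x => by ring
      simp_rw [e]
      have i1 : Integrable (fun x => 2 * c * logRatio π₀ π x) ν := hi.const_mul _
      have i2 : Integrable (fun x => logRatio π₀ π x ^ 2 - 2 * c * logRatio π₀ π x) ν :=
        hi2.sub i1
      rw [integral_add i2 (integrable_const _), integral_sub hi2 i1, integral_const_mul, hmean]
      simp
      nlinarith [sq_nonneg c])
    (s := θ / (L + 2)) (by positivity)
    (by
      have : θ / (L + 2) * (2 * (L + 2)) = 2 * θ := by field_simp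
      rw [this]; linarith) x
  refine le_trans (measure_mono fun ω hω => ?_) h
  have hω' : _ ≤ ∑ t ∈ Finset.range N, (c - logRatio π₀ π (Z t ω)) := hω
  refine le_trans (le_of_eq ?_) hω'
  push_cast
  field_simp
  ring

end Deviation

/-! ### Oracle inequality -/

section Oracle

/-- This `θ` makes `θ (Δ + e)` and `e / θ` both multiples of `√(e (Δ + e))`, which is at most `√(Δ
e) + e`. Absorbing `20 θ K` at once would inflate the coefficient of `Δ`, so two passes are made. -/
theorem sub_le_of_quadratic_oracle {K Δ e r θ : ℝ} (hK : 0 ≤ K) (hΔ : 0 ≤ Δ) (he : 0 < e)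
    (hr0 : 0 ≤ r) (hr : r ≤ e) (hθ : θ = Real.sqrt e / (40 * Real.sqrt (Δ + e)))
    (h : K ≤ Δ + 5 * r + 20 * θ * (K + Δ + 3 * r) + 6 * e / θ) :
    K - Δ ≤ 500 * (e + Real.sqrt (Δ * e)) := by
  set a := Real.sqrt e with ha
  set b := Real.sqrt (Δ + e) with hb
  set c := Real.sqrt Δ with hc
  have ha0 : 0 < a := Real.sqrt_pos.2 he
  have hb0 : 0 < b := Real.sqrt_pos.2 (by linarith)
  have hc0 : 0 ≤ c := Real.sqrt_nonneg _
  have ha2 : a ^ 2 = e := Real.sq_sqrt he.le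
  have hb2 : b ^ 2 = Δ + e := Real.sq_sqrt (by linarith)
  have hc2 : c ^ 2 = Δ := Real.sq_sqrt hΔ
  have hbca : b ≤ c + a := by
    apply le_of_sq_le_sq _ (by positivity)
    nlinarith [mul_nonneg hc0 ha0.le]
  have hab : a ≤ b := Real.sqrt_le_sqrt (by linarith)
  have hθ0 : 0 < θ := by rw [hθ]; positivity
  have hθ1 : θ ≤ 1 / 40 := by
    rw [hθ, div_le_div_iff₀ (by positivity) (by norm_num)]; linarith
  have e1 : 6 * e / θ = 240 * (a * b) := by rw [hθ, ← ha2]; field_simp; norm_num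
  have e2 : θ * (Δ + e) = a * b / 40 := by rw [hθ, ← hb2]; field_simp
  have e3 : θ * (a * b) = e / 40 := by rw [hθ, ← ha2]; field_simp
  have e4 : Real.sqrt (Δ * e) = c * a := Real.sqrt_mul hΔ e
  have hab2 : a * b ≤ c * a + e := by rw [← ha2]; nlinarith
  rw [e1] at h
  have hθK : θ * K ≤ 1 / 40 * K := by gcongr
  have hθD : θ * (Δ + 3 * r) ≤ 1 / 40 * (Δ + 3 * r) := by gcongr
  -- First pass: `θ ≤ 1/40` gives `20 θ K ≤ K / 2`, hence a crude bound. It is then inserted only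
  -- into the term `θ K`, where its `Δ` carries a factor `θ`.
  have hK2 : K ≤ 3 * Δ + 13 * r + 480 * (a * b) := by linarith
  have h5 := mul_le_mul_of_nonneg_left hK2 hθ0.le
  have h6 : θ * r ≤ θ * e := by gcongr
  have h7 : 0 ≤ θ * Δ := by positivity
  have h8 : 0 ≤ θ * e := by positivity
  have h9 : 0 ≤ c * a := by positivity
  rw [e4]
  have h10 : θ * K ≤ 3 * (θ * Δ) + 13 * (θ * r) + 12 * e := by
    calc θ * K ≤ θ * (3 * Δ + 13 * r + 480 * (a * b)) := h5
      _ = 3 * (θ * Δ) + 13 * (θ * r) + 480 * (θ * (a * b)) := by ring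
      _ = _ := by rw [e3]; ring
  have e2' : θ * Δ + θ * e = a * b / 40 := by rw [← e2]; ring
  have h' : K ≤ Δ + 5 * r + 20 * (θ * K) + 20 * (θ * Δ) + 60 * (θ * r) + 240 * (a * b) := by
    linarith
  linarith

variable {S A : Type*} [MeasurableSpace S] [MeasurableSpace A] [Finite A]
  [MeasurableSingletonClass A]

theorem abs_expKL_sub_le {α : ℝ} (hα : 0 < α) (hα1 : α ≤ 1) (d : Measure S)
    [IsProbabilityMeasure d] (π π₁ π₂ : Policy S A) (hπ₁ : ∀ s a, α ≤ π₁.prob s a)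
    (hπ₂ : ∀ s a, α ≤ π₂.prob s a) {η : ℝ} (h : ∀ x, |logRatio π₁ π₂ x| ≤ η) :
    |expKL d π π₂ - expKL d π π₁| ≤ η := by
  rw [← integral_logRatio_eq_sub hα hα1 d π π₁ π₂ hπ₁ hπ₂]
  have := norm_integral_le_of_norm_le_const (μ := stateActionLaw d π) (f := logRatio π₁ π₂)
    (Filter.Eventually.of_forall h)
  simpa using this

/-- The penalized maximum likelihood estimator satisfies an oracle inequality as soon as the
empirical log-likelihood ratio of a nearby policy `π'` is close to its mean. -/
theorem IsPenalizedMLE.expKL_le_of_deviation {α : ℝ} (hα : 0 < α) (hα1 : α ≤ 1) (d : Measure S)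
    [IsProbabilityMeasure d] {πstar π₀ π' πhat : Policy S A} {F : Set (Policy S A)}
    {pen : Policy S A → ℝ} {N : ℕ} (hN : 0 < N) {z : ℕ → S × A}
    (hhat : IsPenalizedMLE F pen N z πhat) (hpen : 0 ≤ pen πhat) (hπ₀F : π₀ ∈ F)
    (hπ' : ∀ s a, α ≤ π'.prob s a) (hπhat : ∀ s a, α ≤ πhat.prob s a) {η v : ℝ}
    (hη : ∀ x, |logRatio π' πhat x| ≤ η)
    (hdev : ∑ t ∈ Finset.range N, (expKL d πstar π' - expKL d πstar π₀ - logRatio π₀ π' (z t))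
      ≤ v * N) :
    expKL d πstar πhat ≤ expKL d πstar π₀ + pen π₀ + 2 * η + v := by
  have hN' : (0 : ℝ) < N := by exact_mod_cast hN
  have h1 := (abs_le.1 (abs_expKL_sub_le hα hα1 d πstar π' πhat hπ' hπhat hη)).2
  have h2 := hhat.2 π₀ hπ₀F
  have h3 : empiricalLoss N z πhat - empiricalLoss N z π₀
      = (1 / (N : ℝ)) * ∑ t ∈ Finset.range N, logRatio π₀ πhat (z t) := by
    rw [empiricalLoss, empiricalLoss, ← mul_sub, ← Finset.sum_sub_distrib]
    congr 1
    refine Finset.sum_congr rfl fun t _ => ?_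
    rw [logRatio]; ring
  -- The minimizing property against `π₀`, after dropping the nonnegative penalty of the estimator.
  -- The `2 η` in the conclusion pays for replacing `πhat` by `π'` once in the empirical sum and
  -- once in the mean.
  have h4 : ∑ t ∈ Finset.range N, logRatio π₀ πhat (z t) ≤ N * (pen π₀) := by
    have : (1 / (N : ℝ)) * ∑ t ∈ Finset.range N, logRatio π₀ πhat (z t) ≤ pen π₀ := by
      rw [← h3]; linarith
    rw [one_div, inv_mul_le_iff₀ hN'] at this
    exact this
  have h5 : ∑ t ∈ Finset.range N, logRatio π₀ π' (z t)
      ≤ ∑ t ∈ Finset.range N, logRatio π₀ πhat (z t) + N * η := by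
    have : ∀ t ∈ Finset.range N, logRatio π₀ π' (z t) ≤ logRatio π₀ πhat (z t) + η :=
      fun t _ => by
        have := (abs_le.1 (hη (z t))).1
        simp only [logRatio] at this ⊢
        linarith
    refine (Finset.sum_le_sum this).trans_eq ?_
    rw [Finset.sum_add_distrib]
    simp
  rw [Finset.sum_sub_distrib] at hdev
  simp only [Finset.sum_const, Finset.card_range, nsmul_eq_mul] at hdev
  have h6 : N * (expKL d πstar π' - expKL d πstar π₀) ≤ N * (pen π₀ + η + v) := by linarith
  have := le_of_mul_le_mul_left h6 hN'
  linarith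

end Oracle

/-! ### Main theorem -/

theorem theorem1 :
    ∃ C : ℝ, 0 < C ∧
    -- states and actions
    ∀ (S A : Type*) [MeasurableSpace S] [MeasurableSpace A] [Finite A]
      [MeasurableSingletonClass A]
    -- transition law, discount, temperature
      (P : Kernel (S × A) S) [IsMarkovKernel P]
      (γ lam : ℝ) (_ : 0 < γ) (_ : γ < 1) (_ : 0 < lam)
    -- expert policy and invariant state law, uniform ergodicity of the state-action chain
      (πstar : Policy S A) (d : Measure S) [IsProbabilityMeasure d]
      (_ : Kernel.Invariant (stateKernel P πstar) d)
      (τ : ℕ) (_ : UniformlyGeomErgodic (jointKernel P πstar) (stateActionLaw d πstar) τ)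
    -- policy class and penalty
      (F : Set (Policy S A)) (α D Λ : ℝ) (_ : 0 < α) (_ : 1 ≤ D) (_ : 0 < Λ)
      (_ : Policy.HasUniformFloor F α) (_ : Policy.HasLogCovering F D Λ)
      (pen : Policy S A → ℝ) (_ : ∀ π ∈ F, 0 ≤ pen π)
    -- weighting measure with density `w` with respect to the state-action law
      (ρ : Measure (S × A)) (w : S × A → ℝ) (_ : Measurable w)
      (_ : 0 < ⨅ x, w x) (_ : BddAbove (Set.range w))
      (_ : ρ = (stateActionLaw d πstar).withDensity (fun x => ENNReal.ofReal (w x)))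
    -- the data
      (N : ℕ) (_ : 2 * τ ≤ N) (_ : α * τ ≤ Λ * N)
      (Ω : Type*) [MeasurableSpace Ω] (μ : Measure Ω) [IsProbabilityMeasure μ]
      (Z : ℕ → Ω → S × A) (_ : IsMarkovChain μ (jointKernel P πstar) N Z)
    -- the estimators and the target reward
      (πhat : Ω → Policy S A) (_ : ∀ ω, IsPenalizedMLE F pen N (fun t => Z t ω) (πhat ω))
      (fhat : Ω → S → ℝ) (_ : ∀ ω, IsLSPotential P γ lam d ρ (πhat ω) (fhat ω))
      (fstar : S → ℝ) (_ : IsLSPotential P γ lam d ρ πstar fstar)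
      (δ : ℝ) (_ : 0 < δ) (_ : δ < 1),
    -- outside an event of probability at most `δ`, both bounds hold
    μ {ω | ¬ (
        expKL d πstar (πhat ω) - approxError d πstar F pen
          ≤ C * (complexityM D Λ N α τ δ * τ / N
              + Real.sqrt (approxError d πstar F pen * complexityM D Λ N α τ δ * τ / N))
        ∧
        eLpNorm (fun x => shapedReward P γ lam (πhat ω) (fhat ω) x
              - shapedReward P γ lam πstar fstar x) 2 (stateActionLaw d πstar) ^ 2
          ≤ ENNReal.ofReal (C * (lam ^ 2 * ((⨆ x, w x) / (⨅ x, w x)) * (Real.log (1 / α) + 2)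
              * (approxError d πstar F pen + complexityM D Λ N α τ δ * τ / N))))}
      ≤ ENNReal.ofReal δ := by
  refine ⟨2000, by norm_num, ?_⟩
  intro S A _ _ _ _ P _ γ lam _ _ _ πstar d _ hinv τ herg F α D Λ hα hD hΛ hfloor hcov pen hpen
    ρ w hw hw0 hwb hρ N hN2 hNΛ Ω _ μ _ Z hZ πhat hhat fhat hfhat fstar hfstar δ hδ hδ1
  have hτ : 1 ≤ τ := herg.1
  have hN : 0 < N := by omega
  have hτ' : (0 : ℝ) < τ := by exact_mod_cast hτ
  have hN' : (0 : ℝ) < N := by exact_mod_cast hN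
  obtain ⟨ω₀⟩ : Nonempty Ω := nonempty_of_isProbabilityMeasure μ
  have hF : F.Nonempty := ⟨_, (hhat ω₀).1⟩
  obtain ⟨s₀⟩ : Nonempty S := nonempty_of_isProbabilityMeasure d
  obtain ⟨a₀⟩ : Nonempty A := nonempty_of_isProbabilityMeasure (πstar.kernel s₀)
  have hα1 : α ≤ 1 := (hfloor _ hF.some_mem s₀ a₀).trans (Policy.prob_le_one _ _ _)
  set L := Real.log (1 / α) with hL
  have hL0 : 0 ≤ L := Real.log_nonneg (one_le_one_div hα hα1)
  set Δ := approxError d πstar F pen with hΔdef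
  have hΔ : 0 ≤ Δ := Real.iInf_nonneg fun π =>
    add_nonneg (expKL_nonneg d πstar π) (hpen π π.2)
  -- The logarithm is `1/α`-Lipschitz above `α`, so a net of radius `2 ε` moves log-ratios by at
  -- most `2 τ / N`, which is of lower order than `e`.
  set ε : ℝ := α * τ / N with hε
  have hε0 : 0 < ε := by positivity
  have hεΛ : ε ≤ Λ := by rw [hε, div_le_iff₀ hN']; exact hNΛ
  set X : ℝ := D * Real.log (Λ * N / (α * τ)) + Real.log (2 / δ) with hX
  have hΛε : Λ / ε = Λ * N / (α * τ) := by rw [hε]; field_simp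
  have hlogΛ : 0 ≤ D * Real.log (Λ / ε) :=
    mul_nonneg (by linarith) (Real.log_nonneg ((one_le_div hε0).2 hεΛ))
  have hlogδ : Real.log 2 ≤ Real.log (2 / δ) := by
    apply Real.log_le_log two_pos
    rw [le_div_iff₀ hδ]; linarith
  have hlog2 := Real.log_two_gt_d9
  have hXpos : Real.log 2 ≤ X := by rw [hX, ← hΛε]; linarith
  set e : ℝ := complexityM D Λ N α τ δ * τ / N with he
  have heX : e = X * (L + 2) * τ / N := rfl
  set r : ℝ := τ / N with hr
  have hr0 : 0 < r := by positivity
  have hre : r ≤ e := by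
    have h1 : 1 ≤ X * (L + 2) := by nlinarith
    calc r = 1 * (τ / N) := by rw [one_mul]
      _ ≤ X * (L + 2) * (τ / N) := by gcongr
      _ = e := by rw [heX, mul_div_assoc]
  have he0 : 0 < e := hr0.trans_le hre
  -- The infimum defining `Δ` may not be attained; an excess of `r ≤ e` is affordable.
  obtain ⟨π₀, hπ₀⟩ : ∃ π : F, expKL d πstar π + pen π < Δ + r := by
    have : Nonempty F := hF.to_subtype
    exact exists_lt_of_ciInf_lt (lt_add_of_pos_right Δ hr0)
  obtain ⟨π₀, hπ₀F⟩ := π₀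
  simp only at hπ₀
  have hK₀ : expKL d πstar π₀ ≤ Δ + r := by linarith [hpen π₀ hπ₀F]
  set θ : ℝ := Real.sqrt e / (40 * Real.sqrt (Δ + e)) with hθ
  have hsq : 0 < Real.sqrt (Δ + e) := Real.sqrt_pos.2 (by linarith)
  have hθ0 : 0 < θ := div_pos (Real.sqrt_pos.2 he0) (by linarith)
  have hθ1 : θ ≤ 1 / 4 := by
    have : Real.sqrt e ≤ Real.sqrt (Δ + e) := Real.sqrt_le_sqrt (by linarith)
    rw [hθ, div_le_div_iff₀ (by positivity) (by norm_num)]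
    linarith
  obtain ⟨G, hGF, hGcard, hGnet⟩ := hcov.exists_finset_net hF hε0 hεΛ
  -- With this `x`, `4 exp (-x)` is `δ` divided by the bound on the size of the net: `X` supplies `δ
  -- / 2`, and the added `log 2` removes the remaining factor.
  set x : ℝ := X + Real.log 2 with hx
  let B : Policy S A → Set Ω := fun π =>
    {ω | 20 * θ * (expKL d πstar π + expKL d πstar π₀) * N + 3 * τ * (L + 2) * x / θ
        ≤ ∑ t ∈ Finset.range N, (expKL d πstar π - expKL d πstar π₀ - logRatio π₀ π (Z t ω))}
  have hB : μ (⋃ π ∈ G, B π) ≤ ENNReal.ofReal δ := by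
    calc μ (⋃ π ∈ G, B π) ≤ ∑ π ∈ G, μ (B π) := measure_biUnion_finset_le _ _
      _ ≤ ∑ π ∈ G, ENNReal.ofReal (4 * Real.exp (-x)) := Finset.sum_le_sum fun π hπ =>
          measure_logRatio_deviation_le hinv herg hZ hα hα1 (hfloor π₀ hπ₀F)
            (hfloor π (hGF π hπ)) hθ0 hθ1 x
      _ = (G.card : ℝ≥0∞) * ENNReal.ofReal (4 * Real.exp (-x)) := by
          rw [Finset.sum_const, nsmul_eq_mul]
      _ ≤ ENNReal.ofReal (Real.exp (D * Real.log (Λ / ε))) *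
            ENNReal.ofReal (4 * Real.exp (-x)) := by gcongr
      _ = ENNReal.ofReal δ := by
          rw [← ENNReal.ofReal_mul (Real.exp_pos _).le]
          congr 1
          have h1 : Real.exp (-x)
              = (Real.exp (D * Real.log (Λ / ε)))⁻¹ * (2 / δ)⁻¹ * 2⁻¹ := by
            rw [hx, hX, ← hΛε, neg_add, neg_add, Real.exp_add, Real.exp_add, Real.exp_neg,
              Real.exp_neg, Real.exp_neg, Real.exp_log (by positivity), Real.exp_log two_pos]
          rw [h1]
          field_simp
          norm_num
  refine (measure_mono fun ω hω => ?_).trans hB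
  by_contra hgood
  apply hω
  have hhatF : πhat ω ∈ F := (hhat ω).1
  obtain ⟨π', hπ'G, hπ'⟩ := hGnet _ hhatF
  have hfl' := hfloor π' (hGF π' hπ'G)
  have hflhat := hfloor _ hhatF
  have hη : ∀ y, |logRatio π' (πhat ω) y| ≤ 2 * r := fun y => by
    refine (abs_log_sub_log_le hα (hfl' y.1 y.2) (hflhat y.1 y.2)).trans ?_
    rw [abs_sub_comm]
    calc _ ≤ 2 * ε / α := by gcongr; exact hπ' y.1 y.2
      _ = 2 * r := by rw [hε, hr]; field_simp
  have hdev : ∑ t ∈ Finset.range N,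
      (expKL d πstar π' - expKL d πstar π₀ - logRatio π₀ π' (Z t ω))
      ≤ (20 * θ * (expKL d πstar π' + expKL d πstar π₀) + 6 * e / θ) * N := by
    have h1 : ω ∉ B π' := fun hmem => hgood (Set.mem_biUnion hπ'G hmem)
    have h2 : _ < 20 * θ * (expKL d πstar π' + expKL d πstar π₀) * N
      + 3 * τ * (L + 2) * x / θ := not_le.1 h1
    refine h2.le.trans ?_
    rw [add_mul]
    gcongr
    have h3 : x ≤ 2 * X := by rw [hx]; linarith
    calc 3 * τ * (L + 2) * x / θ ≤ 3 * τ * (L + 2) * (2 * X) / θ := by gcongr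
      _ = 6 * e / θ * N := by rw [heX]; field_simp; ring
  have horacle := (hhat ω).expKL_le_of_deviation hα hα1 d hN (hpen _ hhatF) hπ₀F hfl' hflhat hη hdev
  have hclose := (abs_le.1 (abs_expKL_sub_le hα hα1 d πstar π' (πhat ω) hfl' hflhat hη)).1
  have hKhat0 := expKL_nonneg d πstar (πhat ω)
  have hmain : expKL d πstar (πhat ω) - Δ ≤ 500 * (e + Real.sqrt (Δ * e)) := by
    refine sub_le_of_quadratic_oracle hKhat0 hΔ he0 hr0.le hre hθ ?_
    -- The `3 r` consists of `2 r` for passing from `π'` to the estimator and `r` for the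
    -- near-minimality of `π₀`.
    have : 20 * θ * (expKL d πstar π' + expKL d πstar π₀)
        ≤ 20 * θ * (expKL d πstar (πhat ω) + Δ + 3 * r) := by
      refine mul_le_mul_of_nonneg_left ?_ (by positivity)
      linarith
    linarith
  have hsqrt0 : 0 ≤ Real.sqrt (Δ * e) := Real.sqrt_nonneg _
  constructor
  · have h1 : Δ * complexityM D Λ N α τ δ * τ / N = Δ * e := by rw [he]; ring
    rw [h1]
    linarith
  · refine (eLpNorm_shapedReward_sub_sq_le hα hα1 hinv hw hw0 hwb hρ hflhat (hfhat ω)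
      hfstar).trans (ENNReal.ofReal_le_ofReal ?_)
    have hamgm : Real.sqrt (Δ * e) ≤ (Δ + e) / 2 := by
      apply Real.sqrt_le_iff.2
      constructor
      · linarith
      · nlinarith [sq_nonneg (Δ - e)]
    have hκ : 0 ≤ (⨆ x, w x) / (⨅ x, w x) := by
      have : Nonempty (S × A) := ⟨(s₀, a₀)⟩
      refine div_nonneg (hw0.le.trans ?_) hw0.le
      exact ciInf_le_ciSup (by
        by_contra hb
        exact hw0.ne' (Real.iInf_of_not_bddBelow hb)) hwb
    -- By AM-GM the divergence is at most `251 Δ + 750 e ≤ 1000 (Δ + e)`; the factor `2` of the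
    -- second-moment bound yields `C = 2000`.
    calc lam ^ 2 * ((⨆ x, w x) / (⨅ x, w x)) * (2 * (L + 2) * expKL d πstar (πhat ω))
        ≤ lam ^ 2 * ((⨆ x, w x) / (⨅ x, w x)) * (2 * (L + 2) * (1000 * (Δ + e))) := by
          gcongr
          linarith
      _ = _ := by ring
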